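/- For a finite group $G$, let $\rho(G)$ be the probability that two elements $g, h \in G$, chosen independently and uniformly at random, have conjugates that commute (that is, some conjugate of $g$ commutes with some conjugate of $h$). Let $S_n$ be the symmetric group of degree $n$, and let $C_\rho = 10^2\rho(S_{10})$. Then for every positive integer $n$, $$\rho(S_n) \le \frac{C_\rho}{n^2}.$$ The constant $C_\rho$ is best possible: if $C$ is a real number such that $\rho(S_n) \le C/n^2$ for all positive integers $n$, then $C_\rho \le C$. Moreover $11.42747 < C_\rho < 11.42748$. -/

import Mathlib

/-- Two elements `g` and `h` of a group have conjugates that commute. -/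
def HaveCommutingConjugates {G : Type*} [Group G] (g h : G) : Prop :=
  ∃ a b : G, IsConj g a ∧ IsConj h b ∧ Commute a b

/-- `rho G` is the probability that two elements of the finite group `G`, chosen independently and
uniformly at random, have conjugates that commute. -/
noncomputable def rho (G : Type*) [Group G] [Finite G] : ℝ :=
  (Nat.card {p : G × G // HaveCommutingConjugates p.1 p.2} : ℝ) / (Nat.card (G × G) : ℝ)

/-- The constant `10 ^ 2 * rho (S_10)`, where `S_n` is the symmetric group of degree `n`. -/
noncomputable def constRho : ℝ := 10 ^ 2 * rho (Equiv.Perm (Fin 10))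

/-! # Commuting conjugates in the symmetric groups

Let `g` and `h` be commuting permutations of a finite set. The points that lie on a cycle of `g` of
length `a` and on a cycle of `h` of length `b` form a set invariant under both, so their number is a
multiple of `lcm a b`. Conversely, two rotations of `ZMod (lcm a b)` realize the *block* `(a, b)`:
commuting permutations of `lcm a b` points, the first with all cycles of length `a` and the second
with all cycles of length `b`. Hence `g` and `h` in `S_n` have commuting conjugates if and only if
their pair of cycle types is a sum of blocks (`haveCommutingConjugates_iff`), and by Cauchy's
formula `rho (S_n)` is the sum of the products of the weights of the two cycle types over all such
pairs (`rho_perm_eq`). This sum is `blockProb (fun _ => true) n`; more generally `blockProb T n`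
only allows blocks that satisfy `T`.

Choosing a decomposition of every pair, marking one of the `n` points and removing the block that
contains it gives the linear recursion `n * blockProb T n ≤ ∑ m, recCoef T m * blockProb T (n - m)`
(`mul_blockProb_le`), where `recCoef T m` is at most about `1 / m`. This is wasteful for small
blocks, since a pair usually has many decompositions that use them. Therefore a pair is divided into the
part built from the blocks with cycle lengths at most `6` and the rest (`blockProb_le_sum`). For the
small blocks, accurate bounds in degrees up to `15` start the recursion; they come from an
enumeration of the pairs of partitions, in which the set of partners of a partition is a bit mask
that is updated part by part. For the other blocks the recursion starts in degree `0`. This proves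
`n ^ 2 * rho (S_n) ≤ 11.42747` for all `n ≤ 120` except `n = 10`.

For `n > 120` the same bound follows by induction from the recursion without restriction on the
blocks: in the sum over `i + m = n` the terms with `i < 30` are controlled by the computed bounds,
those with `m < 30` by the computed coefficients, and the remaining ones by
`recCoef T m ≤ (1 + 13 / 2 / m) ^ 2 / m` (`recCoef_le`). Finally, in degree `10` the enumeration
with rounding down and with rounding up shows that `100 * rho (S_10)` lies strictly between
`11.42747` and `11.42748`. So the maximum of `n ^ 2 * rho (S_n)` is attained at `n = 10`, and all
assertions follow.
-/

/-! ### Weights of cycle types -/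

/-- The order of the centralizer in `S_n` of a permutation of cycle type `s`, where `s` is the
multiset of *all* cycle lengths, including the fixed points. -/
def zee (s : Multiset ℕ) : ℕ := s.prod * ∏ a ∈ s.toFinset, (s.count a).factorial

/-- The probability that a random permutation of `s.sum` points has cycle type `s`. -/
noncomputable def wt (s : Multiset ℕ) : ℝ := (zee s : ℝ)⁻¹

theorem zee_eq_of_subset {s : Multiset ℕ} {F : Finset ℕ} (h : s.toFinset ⊆ F) :
    zee s = s.prod * ∏ a ∈ F, (s.count a).factorial := by
  unfold zee
  congr 1
  refine Finset.prod_subset h fun a _ ha => ?_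
  rw [Multiset.mem_toFinset] at ha
  simp [Multiset.count_eq_zero_of_notMem ha]

theorem zee_pos {s : Multiset ℕ} (h : ∀ a ∈ s, 0 < a) : 0 < zee s := by
  unfold zee
  refine Nat.mul_pos (Nat.pos_of_ne_zero fun h0 => ?_)
    (Finset.prod_pos fun a _ => Nat.factorial_pos _)
  exact absurd (h 0 (Multiset.prod_eq_zero_iff.1 h0)) (lt_irrefl 0)

theorem wt_nonneg (s : Multiset ℕ) : 0 ≤ wt s := by unfold wt; positivity

theorem wt_zero : wt 0 = 1 := by simp [wt, zee]

theorem zee_mul_zee_le (s t : Multiset ℕ) : zee s * zee t ≤ zee (s + t) := by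
  have hs : s.toFinset ⊆ (s + t).toFinset := by
    rw [Multiset.toFinset_add]; exact Finset.subset_union_left
  have ht : t.toFinset ⊆ (s + t).toFinset := by
    rw [Multiset.toFinset_add]; exact Finset.subset_union_right
  rw [zee_eq_of_subset hs, zee_eq_of_subset ht, zee, Multiset.prod_add,
    mul_mul_mul_comm, ← Finset.prod_mul_distrib]
  refine Nat.mul_le_mul_left _ (Finset.prod_le_prod' fun a _ => ?_)
  rw [Multiset.count_add]
  exact Nat.le_of_dvd (Nat.factorial_pos _) (Nat.factorial_mul_factorial_dvd_factorial_add _ _)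

theorem wt_add_le {s t : Multiset ℕ} (hs : ∀ a ∈ s, 0 < a) (ht : ∀ a ∈ t, 0 < a) :
    wt (s + t) ≤ wt s * wt t := by
  unfold wt
  rw [← mul_inv]
  have := zee_pos hs
  have := zee_pos ht
  refine inv_anti₀ (by positivity) ?_
  exact_mod_cast zee_mul_zee_le s t

theorem zee_replicate (j a : ℕ) :
    zee (Multiset.replicate j a) = a ^ j * j.factorial := by
  rw [zee_eq_of_subset (F := {a})]
  · simp
  · intro x hx
    rw [Multiset.mem_toFinset] at hx
    simpa using Multiset.eq_of_mem_replicate hx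

theorem wt_replicate (j a : ℕ) :
    wt (Multiset.replicate j a) = ((a : ℝ) ^ j * j.factorial)⁻¹ := by
  simp [wt, zee_replicate]

theorem zee_add_replicate (s : Multiset ℕ) (j a : ℕ) :
    zee (s + Multiset.replicate j a) =
      zee s * zee (Multiset.replicate j a) * (s.count a + j).choose j := by
  set F : Finset ℕ := insert a s.toFinset with hF
  have hs : s.toFinset ⊆ F := Finset.subset_insert _ _
  have hsr : (s + Multiset.replicate j a).toFinset ⊆ F := by
    intro x hx
    simp only [Multiset.mem_toFinset, Multiset.mem_add, Multiset.mem_replicate] at hx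
    simp only [hF, Finset.mem_insert, Multiset.mem_toFinset]
    tauto
  have haF : a ∈ F := Finset.mem_insert_self _ _
  rw [zee_eq_of_subset hs, zee_eq_of_subset hsr, zee_replicate, Multiset.prod_add,
    Multiset.prod_replicate, ← Finset.mul_prod_erase F _ haF, ← Finset.mul_prod_erase F _ haF]
  have h1 : ∏ x ∈ F.erase a, ((s + Multiset.replicate j a).count x).factorial =
      ∏ x ∈ F.erase a, (s.count x).factorial := by
    refine Finset.prod_congr rfl fun x hx => ?_
    have : x ≠ a := Finset.ne_of_mem_erase hx
    rw [Multiset.count_add, Multiset.count_replicate, if_neg this.symm, add_zero]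
  rw [h1, Multiset.count_add, Multiset.count_replicate_self,
    ← Nat.add_choose_mul_factorial_mul_factorial (s.count a) j, Nat.add_comm (s.count a) j,
    Nat.choose_symm_add]
  ring

/-- The weight is multiplicative for the addition of `j` cycles of length `a`, up to a binomial
coefficient that is large when there are already many cycles of that length. -/
theorem wt_add_replicate (s : Multiset ℕ) (j a : ℕ) :
    wt (s + Multiset.replicate j a) * (s.count a + j).choose j =
      wt s * wt (Multiset.replicate j a) := by
  have h : ((s.count a + j).choose j : ℝ) ≠ 0 := by
    exact_mod_cast (Nat.choose_pos (Nat.le_add_left _ _)).ne'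
  simp only [wt]
  rw [zee_add_replicate]
  push_cast
  field_simp

theorem le_choose_of_mul_le {e j N : ℕ} (hj : 0 < j) (h : e * j ≤ N) : e ≤ N.choose j := by
  rcases Nat.eq_zero_or_pos e with rfl | he
  · exact Nat.zero_le _
  obtain ⟨i, rfl⟩ : ∃ i, j = i + 1 := ⟨j - 1, by omega⟩
  obtain ⟨M, rfl⟩ : ∃ M, N = M + 1 := ⟨N - 1, by
    have : 0 < e * (i + 1) := Nat.mul_pos he hj
    omega⟩
  have h1 := Nat.add_one_mul_choose_eq M i
  have h2 : i + 1 ≤ M + 1 := le_trans (Nat.le_mul_of_pos_left _ he) h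
  have h3 : 1 ≤ M.choose i := Nat.choose_pos (by omega)
  have h4 : e * (i + 1) ≤ (M + 1).choose (i + 1) * (i + 1) := by
    rw [← h1]; nlinarith
  exact Nat.le_of_mul_le_mul_right h4 hj

/-! ### Pairs of cycle types built from blocks -/

/-- The size `lcm a b` of the block `(a, b)`. -/
def blockSize (t : ℕ × ℕ) : ℕ := Nat.lcm t.1 t.2

/-- The cycle types of the two commuting permutations of a block `(a, b)`: on `lcm a b` points, the
first has all cycles of length `a` and the second has all cycles of length `b`. -/
def blockPair (t : ℕ × ℕ) : Multiset ℕ × Multiset ℕ :=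
  (Multiset.replicate (blockSize t / t.1) t.1, Multiset.replicate (blockSize t / t.2) t.2)

/-- `IsDecomp T D n p` says that the pair `p` of multisets is the sum of the blocks in `D`, that all
these blocks satisfy `T`, and that their sizes add up to `n`. -/
def IsDecomp (T : ℕ × ℕ → Bool) (D : Multiset (ℕ × ℕ)) (n : ℕ)
    (p : Multiset ℕ × Multiset ℕ) : Prop :=
  (∀ t ∈ D, T t = true ∧ 0 < t.1 ∧ 0 < t.2) ∧ (D.map blockSize).sum = n ∧
    (D.map blockPair).sum = p

/-- The pairs of partitions of `n` that can be built from blocks satisfying `T`. -/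
def blockPairs (T : ℕ × ℕ → Bool) (n : ℕ) : Set (Multiset ℕ × Multiset ℕ) :=
  {p | ∃ D, IsDecomp T D n p}

theorem blockSize_pos {t : ℕ × ℕ} (h : 0 < t.1 ∧ 0 < t.2) : 0 < blockSize t :=
  Nat.lcm_pos h.1 h.2

theorem sum_blockPair_fst (t : ℕ × ℕ) : (blockPair t).1.sum = blockSize t := by
  simp [blockPair, blockSize, Nat.div_mul_cancel (Nat.dvd_lcm_left _ _)]

theorem sum_blockPair_snd (t : ℕ × ℕ) : (blockPair t).2.sum = blockSize t := by
  simp [blockPair, blockSize, Nat.div_mul_cancel (Nat.dvd_lcm_right _ _)]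

theorem pos_of_mem_blockPair {t : ℕ × ℕ} (h : 0 < t.1 ∧ 0 < t.2) :
    (∀ a ∈ (blockPair t).1, 0 < a) ∧ ∀ a ∈ (blockPair t).2, 0 < a := by
  constructor <;> intro a ha <;> rw [Multiset.eq_of_mem_replicate ha]
  exacts [h.1, h.2]

section

variable {T : ℕ × ℕ → Bool} {D : Multiset (ℕ × ℕ)} {n : ℕ} {p : Multiset ℕ × Multiset ℕ}

theorem isDecomp_zero : IsDecomp T 0 0 0 := ⟨by simp, by simp, by simp⟩

theorem isDecomp_cons {t : ℕ × ℕ} (ht : T t = true ∧ 0 < t.1 ∧ 0 < t.2) (h : IsDecomp T D n p) :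
    IsDecomp T (t ::ₘ D) (blockSize t + n) (blockPair t + p) := by
  refine ⟨?_, ?_, ?_⟩
  · intro x hx
    rcases Multiset.mem_cons.1 hx with rfl | hx
    exacts [ht, h.1 x hx]
  · rw [Multiset.map_cons, Multiset.sum_cons, h.2.1]
  · rw [Multiset.map_cons, Multiset.sum_cons, h.2.2]

/-- Removing a block from a decomposition. -/
theorem IsDecomp.exists_erase {t : ℕ × ℕ} (h : IsDecomp T D n p) (ht : t ∈ D) :
    ∃ m q, n = blockSize t + m ∧ p = blockPair t + q ∧ IsDecomp T (D.erase t) m q := by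
  refine ⟨((D.erase t).map blockSize).sum, ((D.erase t).map blockPair).sum, ?_, ?_, ?_, rfl, rfl⟩
  · rw [← h.2.1, ← Multiset.sum_cons, ← Multiset.map_cons, Multiset.cons_erase ht]
  · rw [← h.2.2, ← Multiset.sum_cons, ← Multiset.map_cons, Multiset.cons_erase ht]
  · exact fun x hx => h.1 x (Multiset.mem_of_mem_erase hx)

theorem IsDecomp.sum_eq (h : IsDecomp T D n p) : p.1.sum = n ∧ p.2.sum = n := by
  induction D using Multiset.induction generalizing n p with
  | empty =>
    obtain ⟨-, h2, h3⟩ := h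
    simp at h2 h3
    subst h2 h3
    simp
  | cons t D ih =>
    obtain ⟨m, q, rfl, rfl, hq⟩ := h.exists_erase (Multiset.mem_cons_self t D)
    rw [Multiset.erase_cons_head] at hq
    simp [(ih hq).1, (ih hq).2, sum_blockPair_fst, sum_blockPair_snd]

theorem IsDecomp.pos (h : IsDecomp T D n p) : (∀ a ∈ p.1, 0 < a) ∧ ∀ a ∈ p.2, 0 < a := by
  induction D using Multiset.induction generalizing n p with
  | empty =>
    obtain ⟨-, h2, h3⟩ := h
    simp at h3
    subst h3
    simp
  | cons t D ih =>
    obtain ⟨m, q, rfl, rfl, hq⟩ := h.exists_erase (Multiset.mem_cons_self t D)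
    rw [Multiset.erase_cons_head] at hq
    have h1 := pos_of_mem_blockPair (h.1 t (Multiset.mem_cons_self t D)).2
    have h2 := ih hq
    constructor <;> intro a ha
    · rcases Multiset.mem_add.1 ha with ha | ha
      exacts [h1.1 a ha, h2.1 a ha]
    · rcases Multiset.mem_add.1 ha with ha | ha
      exacts [h1.2 a ha, h2.2 a ha]

theorem finite_multiset_sum_eq (n : ℕ) :
    {s : Multiset ℕ | (∀ a ∈ s, 0 < a) ∧ s.sum = n}.Finite := by
  refine (Set.finite_range (fun p : n.Partition => p.parts)).subset ?_
  rintro s ⟨h1, h2⟩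
  exact ⟨⟨s, fun {i} hi => h1 i hi, h2⟩, rfl⟩

theorem finite_blockPairs (T : ℕ × ℕ → Bool) (n : ℕ) : (blockPairs T n).Finite := by
  refine ((finite_multiset_sum_eq n).prod (finite_multiset_sum_eq n)).subset ?_
  rintro p ⟨D, hD⟩
  exact ⟨⟨hD.pos.1, hD.sum_eq.1⟩, ⟨hD.pos.2, hD.sum_eq.2⟩⟩

/-- The probability that the cycle types of two random permutations of `n` points form a pair that
can be built from blocks satisfying `T`. -/
noncomputable def blockProb (T : ℕ × ℕ → Bool) (n : ℕ) : ℝ :=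
  ∑ p ∈ (finite_blockPairs T n).toFinset, wt p.1 * wt p.2

theorem wt_mul_wt_nonneg (p : Multiset ℕ × Multiset ℕ) : 0 ≤ wt p.1 * wt p.2 :=
  mul_nonneg (wt_nonneg _) (wt_nonneg _)

theorem blockProb_nonneg (T : ℕ × ℕ → Bool) (n : ℕ) : 0 ≤ blockProb T n :=
  Finset.sum_nonneg fun p _ => wt_mul_wt_nonneg p

/-- The blocks of size `m` satisfying `T`. -/
def blocksOfSize (T : ℕ × ℕ → Bool) (m : ℕ) : Finset (ℕ × ℕ) :=
  (m.divisors ×ˢ m.divisors).filter fun t => blockSize t = m ∧ T t = true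

theorem mem_blocksOfSize {m : ℕ} (hm : 0 < m) {t : ℕ × ℕ} :
    t ∈ blocksOfSize T m ↔ blockSize t = m ∧ T t = true := by
  simp only [blocksOfSize, Finset.mem_filter, Finset.mem_product, Nat.mem_divisors]
  constructor
  · exact fun h => h.2
  · rintro ⟨rfl, h⟩
    exact ⟨⟨⟨Nat.dvd_lcm_left _ _, hm.ne'⟩, Nat.dvd_lcm_right _ _, hm.ne'⟩, rfl, h⟩

/-- The probability weight of a single block. -/
noncomputable def blockCost (t : ℕ × ℕ) : ℝ := wt (blockPair t).1 * wt (blockPair t).2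

/-- The coefficient of the linear recursion satisfied by `blockProb T`. -/
noncomputable def recCoef (T : ℕ × ℕ → Bool) (m : ℕ) : ℝ :=
  m * ∑ t ∈ blocksOfSize T m, blockCost t

theorem blockCost_nonneg (t : ℕ × ℕ) : 0 ≤ blockCost t := wt_mul_wt_nonneg _

theorem recCoef_nonneg (T : ℕ × ℕ → Bool) (m : ℕ) : 0 ≤ recCoef T m :=
  mul_nonneg m.cast_nonneg (Finset.sum_nonneg fun t _ => blockCost_nonneg t)

theorem IsDecomp.count_mul_le {t : ℕ × ℕ} (h : IsDecomp T D n p) :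
    D.count t * (blockSize t / t.1) ≤ p.1.count t.1 := by
  induction D using Multiset.induction generalizing n p with
  | empty => simp
  | cons s D ih =>
    obtain ⟨m, q, rfl, rfl, hq⟩ := h.exists_erase (Multiset.mem_cons_self s D)
    rw [Multiset.erase_cons_head] at hq
    have := ih hq
    rw [Multiset.count_cons, Prod.fst_add, Multiset.count_add, add_mul, add_comm]
    refine add_le_add ?_ this
    split_ifs with hts
    · subst hts
      simp [blockPair]
    · simp

/-- The multiplicity of a block in a decomposition is compensated by the symmetry of the cycle type,
so that splitting off a block costs at most `blockCost`. -/
theorem IsDecomp.count_mul_wt_le {t : ℕ × ℕ} {q : Multiset ℕ × Multiset ℕ}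
    (h : IsDecomp T D n (q + blockPair t)) (ht : t ∈ D) :
    (D.count t : ℝ) * (wt (q + blockPair t).1 * wt (q + blockPair t).2) ≤
      blockCost t * (wt q.1 * wt q.2) := by
  have hp := (h.1 t ht).2
  have hj : 0 < blockSize t / t.1 := Nat.div_pos (Nat.le_of_dvd (blockSize_pos hp)
    (Nat.dvd_lcm_left _ _)) hp.1
  have hc := h.count_mul_le (t := t)
  rw [Prod.fst_add, Multiset.count_add] at hc
  have e1 : (blockPair t).1.count t.1 = blockSize t / t.1 := by simp [blockPair]
  rw [e1] at hc
  have h1 : ((D.count t : ℕ) : ℝ) ≤ ((q.1.count t.1 + blockSize t / t.1).choose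
      (blockSize t / t.1) : ℕ) := by
    exact_mod_cast le_choose_of_mul_le hj hc
  have h2 : (1 : ℝ) ≤ ((q.2.count t.2 + blockSize t / t.2).choose (blockSize t / t.2) : ℕ) := by
    exact_mod_cast Nat.choose_pos (Nat.le_add_left _ _)
  have e2 := wt_add_replicate q.1 (blockSize t / t.1) t.1
  have e3 := wt_add_replicate q.2 (blockSize t / t.2) t.2
  have w1 : (D.count t : ℝ) * wt (q + blockPair t).1 ≤ wt q.1 * wt (blockPair t).1 := by
    rw [← show _ = wt q.1 * wt (blockPair t).1 from e2, mul_comm]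
    exact mul_le_mul_of_nonneg_left h1 (wt_nonneg _)
  have w2 : wt (q + blockPair t).2 ≤ wt q.2 * wt (blockPair t).2 := by
    rw [← show _ = wt q.2 * wt (blockPair t).2 from e3]
    exact le_mul_of_one_le_right (wt_nonneg _) h2
  calc _ = ((D.count t : ℝ) * wt (q + blockPair t).1) * wt (q + blockPair t).2 := by ring
    _ ≤ (wt q.1 * wt (blockPair t).1) * (wt q.2 * wt (blockPair t).2) :=
        mul_le_mul w1 w2 (wt_nonneg _) (mul_nonneg (wt_nonneg _) (wt_nonneg _))
    _ = _ := by unfold blockCost; ring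

theorem IsDecomp.le_sum_count (h : IsDecomp T D n p) :
    (n : ℝ) ≤ ∑ m ∈ Finset.Icc 1 n, ∑ t ∈ blocksOfSize T m, (m : ℝ) * D.count t := by
  have h0 : n = ∑ t ∈ D.toFinset, D.count t * blockSize t := by
    rw [← h.2.1, Finset.sum_multiset_map_count]
    rfl
  have hmaps : ∀ t ∈ D.toFinset, blockSize t ∈ Finset.Icc 1 n := by
    intro t ht
    rw [Multiset.mem_toFinset] at ht
    rw [Finset.mem_Icc]
    refine ⟨blockSize_pos (h.1 t ht).2, ?_⟩
    rw [← h.2.1]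
    exact Multiset.le_sum_of_mem (Multiset.mem_map_of_mem _ ht)
  have h1 : (n : ℝ) = ∑ t ∈ D.toFinset, (blockSize t : ℝ) * D.count t := by
    conv_lhs => rw [h0]
    push_cast
    exact Finset.sum_congr rfl fun t _ => mul_comm _ _
  rw [h1, ← Finset.sum_fiberwise_of_maps_to hmaps]
  refine Finset.sum_le_sum fun m hm => ?_
  have hm' : 0 < m := (Finset.mem_Icc.1 hm).1
  calc _ = ∑ t ∈ D.toFinset with blockSize t = m, (m : ℝ) * D.count t := by
        refine Finset.sum_congr rfl fun t ht => ?_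
        rw [(Finset.mem_filter.1 ht).2]
    _ ≤ _ := by
        refine Finset.sum_le_sum_of_subset_of_nonneg ?_ fun t _ _ => by positivity
        intro t ht
        rw [Finset.mem_filter, Multiset.mem_toFinset] at ht
        exact (mem_blocksOfSize hm').2 ⟨ht.2, (h.1 t ht.1).1⟩

/-- The linear recursion: for each pair in `blockPairs T n` choose a decomposition, mark one of the
`n` points, and split off the block that contains it. -/
theorem mul_blockProb_le (T : ℕ × ℕ → Bool) (n : ℕ) :
    n * blockProb T n ≤ ∑ m ∈ Finset.Icc 1 n, recCoef T m * blockProb T (n - m) := by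
  classical
  have hex : ∀ p : Multiset ℕ × Multiset ℕ, ∃ D, p ∈ blockPairs T n → IsDecomp T D n p := by
    intro p
    by_cases hp : p ∈ blockPairs T n
    · obtain ⟨D, hD⟩ := hp
      exact ⟨D, fun _ => hD⟩
    · exact ⟨0, fun h => absurd h hp⟩
  choose D hD using hex
  set S := (finite_blockPairs T n).toFinset with hS
  have hDS : ∀ p ∈ S, IsDecomp T (D p) n p := fun p hp => hD p (by simpa [hS] using hp)
  calc (n : ℝ) * blockProb T n = ∑ p ∈ S, (n : ℝ) * (wt p.1 * wt p.2) := by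
        rw [blockProb, Finset.mul_sum]
    _ ≤ ∑ p ∈ S, (∑ m ∈ Finset.Icc 1 n, ∑ t ∈ blocksOfSize T m, (m : ℝ) * (D p).count t) *
          (wt p.1 * wt p.2) := by
        refine Finset.sum_le_sum fun p hp => ?_
        exact mul_le_mul_of_nonneg_right (hDS p hp).le_sum_count (wt_mul_wt_nonneg p)
    _ = ∑ m ∈ Finset.Icc 1 n, ∑ t ∈ blocksOfSize T m,
          (m : ℝ) * ∑ p ∈ S, (D p).count t * (wt p.1 * wt p.2) := by
        simp_rw [Finset.sum_mul, Finset.mul_sum]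
        rw [Finset.sum_comm]
        refine Finset.sum_congr rfl fun m _ => ?_
        rw [Finset.sum_comm]
        refine Finset.sum_congr rfl fun t _ => Finset.sum_congr rfl fun p _ => by ring
    _ ≤ _ := by
        refine Finset.sum_le_sum fun m hm => ?_
        have hm' := Finset.mem_Icc.1 hm
        rw [recCoef, mul_assoc, Finset.sum_mul, ← Finset.mul_sum]
        refine mul_le_mul_of_nonneg_left (Finset.sum_le_sum fun t ht => ?_) m.cast_nonneg
        have hts := ((mem_blocksOfSize hm'.1).1 ht).1
        rw [blockProb, Finset.mul_sum]
        rw [← Finset.sum_filter_add_sum_filter_not S (fun p => t ∈ D p)]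
        rw [Finset.sum_eq_zero (s := S.filter fun p => t ∉ D p), add_zero]
        · have hsub : ∀ p ∈ S.filter (fun p => t ∈ D p), p - blockPair t + blockPair t = p ∧
              p - blockPair t ∈ blockPairs T (n - m) := by
            intro p hp
            rw [Finset.mem_filter] at hp
            obtain ⟨k, q, hk, hq, hdq⟩ := (hDS p hp.1).exists_erase hp.2
            have e : p - blockPair t = q := by
              rw [hq]
              exact add_tsub_cancel_left _ _
            rw [e]
            refine ⟨by rw [hq, add_comm], (D p).erase t, ?_⟩
            rw [hts] at hk
            rw [hk, Nat.add_sub_cancel_left]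
            exact hdq
          calc _ ≤ ∑ p ∈ S.filter (fun p => t ∈ D p), blockCost t *
                (wt (p - blockPair t).1 * wt (p - blockPair t).2) := by
                refine Finset.sum_le_sum fun p hp => ?_
                have h1 := (hsub p hp).1
                rw [Finset.mem_filter] at hp
                have h2 := (hDS p hp.1)
                have h3 := IsDecomp.count_mul_wt_le (t := t) (q := p - blockPair t)
                  (D := D p) (n := n) (T := T) (by rw [h1]; exact h2) hp.2
                rw [h1] at h3
                exact h3
            _ = ∑ q ∈ (S.filter (fun p => t ∈ D p)).image (fun p => p - blockPair t),
                  blockCost t * (wt q.1 * wt q.2) := by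
                rw [Finset.sum_image]
                intro p hp p' hp' he
                have h1 := (hsub p hp).1
                have h2 := (hsub p' hp').1
                dsimp only at he
                rw [← h1, ← h2, he]
            _ ≤ _ := by
                refine Finset.sum_le_sum_of_subset_of_nonneg ?_ fun q _ _ =>
                  mul_nonneg (blockCost_nonneg t) (wt_mul_wt_nonneg q)
                intro q hq
                obtain ⟨p, hp, rfl⟩ := Finset.mem_image.1 hq
                rw [Set.Finite.mem_toFinset]
                exact (hsub p hp).2
        · intro p hp
          rw [Finset.mem_filter] at hp
          simp [Multiset.count_eq_zero_of_notMem hp.2]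

theorem IsDecomp.filter (h : IsDecomp T D n p) (U : ℕ × ℕ → Bool) :
    IsDecomp U (D.filter fun t => U t = true)
      ((D.filter fun t => U t = true).map blockSize).sum
      ((D.filter fun t => U t = true).map blockPair).sum := by
  refine ⟨fun t ht => ?_, rfl, rfl⟩
  rw [Multiset.mem_filter] at ht
  exact ⟨ht.2, (h.1 t ht.1).2⟩

/-- Every pair splits into its part built from the blocks satisfying `U` and the rest. -/
theorem blockProb_le_sum (U : ℕ × ℕ → Bool) (n : ℕ) :
    blockProb (fun _ => true) n ≤
      ∑ j ∈ Finset.range (n + 1), blockProb U j * blockProb (fun t => !U t) (n - j) := by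
  classical
  set S := (finite_blockPairs (fun _ => true) n).toFinset with hS
  have hex : ∀ p ∈ S, ∃ x : (_ : ℕ) × ((Multiset ℕ × Multiset ℕ) × (Multiset ℕ × Multiset ℕ)),
      x.1 ∈ Finset.range (n + 1) ∧ x.2.1 ∈ blockPairs U x.1 ∧
      x.2.2 ∈ blockPairs (fun t => !U t) (n - x.1) ∧ x.2.1 + x.2.2 = p := by
    intro p hp
    obtain ⟨D, hD⟩ : p ∈ blockPairs (fun _ => true) n := by simpa [hS] using hp
    have h1 := hD.filter U
    have h2 := hD.filter (fun t => !U t)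
    have e : (D.filter fun t => U t = true) + (D.filter fun t => (!U t) = true) = D := by
      have := Multiset.filter_add_not (fun t => U t = true) D
      convert this using 3
      simp
    have es := congrArg (fun E => (Multiset.map blockSize E).sum) e
    have ep := congrArg (fun E => (Multiset.map blockPair E).sum) e
    simp only [Multiset.map_add, Multiset.sum_add] at es ep
    rw [hD.2.1] at es
    rw [hD.2.2] at ep
    refine ⟨⟨((D.filter fun t => U t = true).map blockSize).sum, _, _⟩, ?_,
      ⟨D.filter fun t => U t = true, ?_⟩, ⟨D.filter fun t => (!U t) = true, ?_⟩, ep⟩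
    · rw [Finset.mem_range]
      dsimp only
      omega
    · exact h1
    · have : n - ((D.filter fun t => U t = true).map blockSize).sum =
        ((D.filter fun t => (!U t) = true).map blockSize).sum := by omega
      dsimp only
      rw [this]
      exact h2
  choose! f hf using hex
  let g (x : (_ : ℕ) × ((Multiset ℕ × Multiset ℕ) × (Multiset ℕ × Multiset ℕ))) : ℝ :=
    (wt x.2.1.1 * wt x.2.1.2) * (wt x.2.2.1 * wt x.2.2.2)
  have hg : ∀ x, 0 ≤ g x := fun x => mul_nonneg (wt_mul_wt_nonneg _) (wt_mul_wt_nonneg _)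
  let R := (Finset.range (n + 1)).sigma fun j =>
    (finite_blockPairs U j).toFinset ×ˢ (finite_blockPairs (fun t => !U t) (n - j)).toFinset
  calc blockProb (fun _ => true) n = ∑ p ∈ S, wt p.1 * wt p.2 := rfl
    _ ≤ ∑ p ∈ S, g (f p) := by
        refine Finset.sum_le_sum fun p hp => ?_
        obtain ⟨-, ⟨D1, h1⟩, ⟨D2, h2⟩, h3⟩ := hf p hp
        have e1 : p.1 = (f p).2.1.1 + (f p).2.2.1 := by rw [← Prod.fst_add, h3]
        have e2 : p.2 = (f p).2.1.2 + (f p).2.2.2 := by rw [← Prod.snd_add, h3]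
        rw [e1, e2]
        calc _ ≤ (wt (f p).2.1.1 * wt (f p).2.2.1) * (wt (f p).2.1.2 * wt (f p).2.2.2) :=
              mul_le_mul (wt_add_le h1.pos.1 h2.pos.1) (wt_add_le h1.pos.2 h2.pos.2)
                (wt_nonneg _) (mul_nonneg (wt_nonneg _) (wt_nonneg _))
          _ = g (f p) := by simp only [g]; ring
    _ = ∑ x ∈ S.image f, g x := by
        rw [Finset.sum_image]
        intro p hp p' hp' he
        rw [← (hf p hp).2.2.2, ← (hf p' hp').2.2.2, he]
    _ ≤ ∑ x ∈ R, g x := by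
        refine Finset.sum_le_sum_of_subset_of_nonneg ?_ fun x _ _ => hg x
        intro x hx
        obtain ⟨p, hp, rfl⟩ := Finset.mem_image.1 hx
        obtain ⟨h0, h1, h2, -⟩ := hf p hp
        simp only [R, Finset.mem_sigma, Finset.mem_product, Set.Finite.mem_toFinset]
        exact ⟨h0, h1, h2⟩
    _ = _ := by
        simp only [R, g]
        rw [Finset.sum_sigma]
        refine Finset.sum_congr rfl fun j _ => ?_
        rw [blockProb, blockProb, Finset.sum_mul_sum, Finset.sum_product]

end

/-! ### Cycle types of commuting permutations -/

section

open Equiv Function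

theorem minimalPeriod_eq_of_forall {β : Type*} {f : β → β} {x : β} {a : ℕ}
    (h : ∀ k, f^[k] x = x ↔ a ∣ k) : minimalPeriod f x = a := by
  refine Nat.dvd_antisymm ?_ ?_
  · exact IsPeriodicPt.minimalPeriod_dvd ((h a).2 dvd_rfl)
  · exact (h _).1 (isPeriodicPt_minimalPeriod f x)

theorem minimalPeriod_eq_card_support_cycleOf {α : Type*} [Fintype α] [DecidableEq α]
    (g : Perm α) {x : α} (hx : x ∈ g.support) :
    minimalPeriod g x = (g.cycleOf x).support.card := by
  refine minimalPeriod_eq_of_forall fun k => ?_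
  rw [Perm.iterate_eq_pow]
  exact (g.isCycleOn_support_cycleOf x).pow_apply_eq
    (Perm.mem_support_cycleOf_iff.2 ⟨Perm.SameCycle.refl _ _, hx⟩)

/-- The number of points on cycles of length `a`. -/
theorem card_minimalPeriod_eq {α : Type*} [Fintype α] [DecidableEq α] (g : Perm α) (a : ℕ) :
    (Finset.univ.filter fun x => minimalPeriod g x = a).card = a * g.partition.parts.count a := by
  classical
  rw [Perm.parts_partition, Multiset.count_add]
  rcases eq_or_ne a 1 with rfl | ha
  · rw [Multiset.count_eq_zero_of_notMem (fun h => lt_irrefl _ (Perm.one_lt_of_mem_cycleType h)),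
      Multiset.count_replicate_self, zero_add, one_mul, ← Finset.card_compl]
    congr 1
    ext x
    simp [minimalPeriod_eq_one_iff_isFixedPt, IsFixedPt]
  · rw [Multiset.count_replicate, if_neg ha.symm, add_zero, Perm.cycleType_def, Multiset.count_map]
    have hmaps : ∀ x ∈ Finset.univ.filter (fun x => minimalPeriod g x = a),
        g.cycleOf x ∈ g.cycleFactorsFinset.filter fun c => a = c.support.card := by
      intro x hx
      rw [Finset.mem_filter] at hx
      have hxs : x ∈ g.support := by
        rw [Perm.mem_support]
        intro h
        exact ha (hx.2.symm.trans (minimalPeriod_eq_one_iff_isFixedPt.2 h))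
      rw [Finset.mem_filter, Perm.cycleOf_mem_cycleFactorsFinset_iff]
      exact ⟨hxs, by rw [← minimalPeriod_eq_card_support_cycleOf g hxs, hx.2]⟩
    rw [Finset.card_eq_sum_card_fiberwise hmaps]
    have hfib : ∀ c ∈ g.cycleFactorsFinset.filter (fun c => a = c.support.card),
        ((Finset.univ.filter fun x => minimalPeriod g x = a).filter
          fun x => g.cycleOf x = c).card = a := by
      intro c hc
      rw [Finset.mem_filter] at hc
      conv_rhs => rw [hc.2]
      congr 1
      ext x
      simp only [Finset.mem_filter, Finset.mem_univ, true_and]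
      constructor
      · rintro ⟨h1, rfl⟩
        have := (Perm.cycleOf_mem_cycleFactorsFinset_iff.1 hc.1)
        rw [Perm.mem_support_cycleOf_iff]
        exact ⟨Perm.SameCycle.refl _ _, this⟩
      · intro h
        have e := Perm.cycle_is_cycleOf h hc.1
        have hxs : x ∈ g.support := by
          rw [e] at hc
          exact Perm.cycleOf_mem_cycleFactorsFinset_iff.1 hc.1
        exact ⟨by rw [minimalPeriod_eq_card_support_cycleOf g hxs, ← e, hc.2], e.symm⟩
    rw [Finset.sum_congr rfl hfib, Finset.sum_const, smul_eq_mul, mul_comm]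
    rfl

theorem parts_partition_eq_iff {α : Type*} [Fintype α] [DecidableEq α] (g : Perm α)
    (s : Multiset ℕ) (hs : ∀ a ∈ s, 0 < a) :
    g.partition.parts = s ↔
      ∀ a, (Finset.univ.filter fun x => minimalPeriod g x = a).card = a * s.count a := by
  constructor
  · rintro rfl a
    exact card_minimalPeriod_eq g a
  · intro h
    ext a
    have h1 := h a
    rw [card_minimalPeriod_eq] at h1
    rcases Nat.eq_zero_or_pos a with rfl | ha
    · rw [Multiset.count_eq_zero_of_notMem fun h => lt_irrefl _ (hs 0 h),
        Multiset.count_eq_zero_of_notMem fun h => lt_irrefl _ (g.partition.parts_pos h)]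
    · exact Nat.eq_of_mul_eq_mul_left ha h1

theorem minimalPeriod_pos_of_perm {α : Type*} [Finite α] (g : Perm α) (x : α) :
    0 < minimalPeriod g x :=
  minimalPeriod_pos_of_mem_periodicPts (g.injective.mem_periodicPts x)

theorem minimalPeriod_perm_apply {α : Type*} [Finite α] (g : Perm α) (x : α) :
    minimalPeriod g (g x) = minimalPeriod g x :=
  minimalPeriod_apply (g.injective.mem_periodicPts x)

theorem minimalPeriod_apply_of_commute {α : Type*} {g h : Perm α} (hc : Commute g h) (x : α) :
    minimalPeriod g (h x) = minimalPeriod g x := by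
  rw [minimalPeriod_eq_minimalPeriod_iff]
  intro k
  have e : (g ^ k) (h x) = h ((g ^ k) x) := by
    rw [← Perm.mul_apply, (hc.pow_left k).eq, Perm.mul_apply]
  simp only [IsPeriodicPt, IsFixedPt, Perm.iterate_eq_pow, e, h.injective.eq_iff]

/-- The size of an invariant set on which all cycles have length `a` is a multiple of `a`. -/
theorem dvd_card_of_minimalPeriod_eq {α : Type*} [Fintype α] [DecidableEq α] (g : Perm α)
    (s : Finset α) (hs : ∀ x, g x ∈ s ↔ x ∈ s) {a : ℕ} (ha : ∀ x ∈ s, minimalPeriod g x = a) :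
    a ∣ s.card := by
  have h1 := card_minimalPeriod_eq (g.subtypePerm (p := (· ∈ s)) hs) a
  have h2 : ∀ x : {x // x ∈ s}, minimalPeriod (g.subtypePerm (p := (· ∈ s)) hs) x = a := by
    intro x
    rw [← ha x x.2, minimalPeriod_eq_minimalPeriod_iff]
    intro k
    simp only [IsPeriodicPt, IsFixedPt, Perm.iterate_eq_pow, Perm.subtypePerm_pow,
      Subtype.ext_iff, Perm.subtypePerm_apply]
  rw [Finset.filter_true_of_mem fun x _ => h2 x, Finset.card_univ] at h1
  exact ⟨_, (Fintype.card_coe s).symm.trans h1⟩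

/-- The cycle types of commuting permutations can be built from blocks: the points whose cycles
under `g` and `h` have the lengths `t.1` and `t.2` form an invariant set, so their number is a
multiple of both lengths. -/
theorem isDecomp_of_commute {α : Type*} [Fintype α] [DecidableEq α] {g h : Perm α}
    (hc : Commute g h) {n : ℕ} (hn : Fintype.card α = n) :
    ∃ D, IsDecomp (fun _ => true) D n (g.partition.parts, h.partition.parts) := by
  classical
  let τ : α → ℕ × ℕ := fun x => (minimalPeriod g x, minimalPeriod h x)
  let X : ℕ × ℕ → Finset α := fun t => Finset.univ.filter fun x => τ x = t
  let I : Finset (ℕ × ℕ) := Finset.univ.image τ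
  have hI : ∀ t ∈ I, 0 < t.1 ∧ 0 < t.2 := by
    intro t ht
    obtain ⟨x, -, rfl⟩ := Finset.mem_image.1 ht
    exact ⟨minimalPeriod_pos_of_perm g x, minimalPeriod_pos_of_perm h x⟩
  have hdvd : ∀ t, blockSize t ∣ (X t).card := by
    intro t
    refine Nat.lcm_dvd ?_ ?_
    · refine dvd_card_of_minimalPeriod_eq g _ (fun x => ?_) fun x hx => ?_
      · simp [X, τ, minimalPeriod_perm_apply, minimalPeriod_apply_of_commute hc.symm]
      · rw [← (Finset.mem_filter.1 hx).2]
    · refine dvd_card_of_minimalPeriod_eq h _ (fun x => ?_) fun x hx => ?_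
      · simp [X, τ, minimalPeriod_perm_apply, minimalPeriod_apply_of_commute hc]
      · rw [← (Finset.mem_filter.1 hx).2]
  let D : Multiset (ℕ × ℕ) := ∑ t ∈ I, ((X t).card / blockSize t) • {t}
  have hmem : ∀ t ∈ D, (fun _ : ℕ × ℕ => true) t = true ∧ 0 < t.1 ∧ 0 < t.2 := by
    intro t ht
    obtain ⟨u, hu, htu⟩ := Multiset.mem_sum.1 ht
    have := Multiset.mem_of_mem_nsmul htu
    rw [Multiset.mem_singleton] at this
    subst this
    exact ⟨rfl, hI _ hu⟩
  have hpair : (D.map blockPair).sum =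
      ∑ t ∈ I, ((X t).card / blockSize t) • blockPair t := by
    have h1 := map_sum ((Multiset.sumAddMonoidHom (M := Multiset ℕ × Multiset ℕ)).comp
      (Multiset.mapAddMonoidHom blockPair)) (fun t => ((X t).card / blockSize t) • {t}) I
    refine h1.trans (Finset.sum_congr rfl fun t _ => ?_)
    rw [map_nsmul]
    congr 1
    exact Multiset.sum_singleton _
  have hcard (π : ℕ × ℕ → ℕ) (a : ℕ) :
      (Finset.univ.filter fun x => π (τ x) = a).card = ∑ t ∈ I with π t = a, (X t).card := by
    have hm : ∀ x ∈ Finset.univ.filter (fun x => π (τ x) = a),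
        τ x ∈ I.filter fun t => π t = a := by
      intro x hx
      rw [Finset.mem_filter] at hx ⊢
      exact ⟨Finset.mem_image_of_mem _ (Finset.mem_univ x), hx.2⟩
    rw [Finset.card_eq_sum_card_fiberwise hm]
    refine Finset.sum_congr rfl fun t ht => congrArg _ ?_
    ext x
    simp only [X, Finset.mem_filter, Finset.mem_univ, true_and]
    constructor
    · exact fun h => h.2
    · rintro rfl
      exact ⟨(Finset.mem_filter.1 ht).2, rfl⟩
  have hmul : ∀ t ∈ I, ∀ a, 0 < a → a ∣ blockSize t →
      a * ((X t).card / blockSize t * (blockSize t / a)) = (X t).card := by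
    intro t ht a ha hd
    obtain ⟨c, hc⟩ := hd
    obtain ⟨d, hd⟩ := hdvd t
    have hb := blockSize_pos (hI t ht)
    rw [hd, Nat.mul_div_cancel_left _ hb, hc, Nat.mul_div_cancel_left _ ha]
    ring
  have hdec : IsDecomp (fun _ => true) D (D.map blockSize).sum
      (g.partition.parts, h.partition.parts) := by
    refine ⟨hmem, rfl, ?_⟩
    rw [hpair]
    refine Prod.ext ?_ ?_
    · symm
      have hfst := map_sum (AddMonoidHom.fst (Multiset ℕ) (Multiset ℕ))
        (fun t => ((X t).card / blockSize t) • blockPair t) I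
      simp only [AddMonoidHom.coe_fst, Prod.smul_fst] at hfst
      dsimp only
      rw [hfst, parts_partition_eq_iff]
      · intro a
        rw [hcard Prod.fst, Multiset.count_sum', Finset.mul_sum, Finset.sum_filter]
        refine Finset.sum_congr rfl fun t ht => ?_
        rw [Multiset.count_nsmul]
        simp only [blockPair, Multiset.count_replicate]
        split_ifs with h
        · subst h
          exact (hmul t ht _ (hI t ht).1 (Nat.dvd_lcm_left _ _)).symm
        · simp
      · intro a ha
        obtain ⟨t, ht, hta⟩ := Multiset.mem_sum.1 ha
        exact (pos_of_mem_blockPair (hI t ht)).1 a (Multiset.mem_of_mem_nsmul hta)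
    · symm
      have hsnd := map_sum (AddMonoidHom.snd (Multiset ℕ) (Multiset ℕ))
        (fun t => ((X t).card / blockSize t) • blockPair t) I
      simp only [AddMonoidHom.coe_snd, Prod.smul_snd] at hsnd
      dsimp only
      rw [hsnd, parts_partition_eq_iff]
      · intro a
        rw [hcard Prod.snd, Multiset.count_sum', Finset.mul_sum, Finset.sum_filter]
        refine Finset.sum_congr rfl fun t ht => ?_
        rw [Multiset.count_nsmul]
        simp only [blockPair, Multiset.count_replicate]
        split_ifs with h
        · subst h
          exact (hmul t ht _ (hI t ht).2 (Nat.dvd_lcm_right _ _)).symm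
        · simp
      · intro a ha
        obtain ⟨t, ht, hta⟩ := Multiset.mem_sum.1 ha
        exact (pos_of_mem_blockPair (hI t ht)).2 a (Multiset.mem_of_mem_nsmul hta)
  rw [← hdec.sum_eq.1.symm.trans (g.partition.parts_sum.trans hn)]
  exact ⟨D, hdec⟩

theorem minimalPeriod_addRight {L a : ℕ} (hL : 0 < L) (ha : a ∣ L) (x : ZMod L) :
    minimalPeriod (Equiv.addRight ((L / a : ℕ) : ZMod L)) x = a := by
  refine minimalPeriod_eq_of_forall fun k => ?_
  obtain ⟨c, rfl⟩ := ha
  have ha : 0 < a := Nat.pos_of_mul_pos_right hL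
  have hc : 0 < c := Nat.pos_of_mul_pos_left hL
  have : ∀ k, (Equiv.addRight ((a * c / a : ℕ) : ZMod (a * c)))^[k] x =
      x + ((k * c : ℕ) : ZMod _) := by
    intro k
    induction k with
    | zero => simp
    | succ k ih =>
      rw [iterate_succ_apply', ih, Nat.mul_div_cancel_left _ ha]
      simp only [Equiv.coe_addRight]
      push_cast
      ring
  rw [this, add_eq_left, ZMod.natCast_eq_zero_iff]
  exact Nat.mul_dvd_mul_iff_right hc

theorem minimalPeriod_sumCongr_inl {α β : Type*} (g : Perm α) (h : Perm β) (x : α) :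
    minimalPeriod (Equiv.sumCongr g h) (Sum.inl x) = minimalPeriod g x := by
  rw [minimalPeriod_eq_minimalPeriod_iff]
  intro k
  have : (Equiv.sumCongr g h)^[k] (Sum.inl x) = Sum.inl (g^[k] x) := by
    induction k with
    | zero => rfl
    | succ k ih => rw [iterate_succ_apply', ih, iterate_succ_apply']; rfl
  simp [IsPeriodicPt, IsFixedPt, this]

theorem minimalPeriod_sumCongr_inr {α β : Type*} (g : Perm α) (h : Perm β) (x : β) :
    minimalPeriod (Equiv.sumCongr g h) (Sum.inr x) = minimalPeriod h x := by
  rw [minimalPeriod_eq_minimalPeriod_iff]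
  intro k
  have : (Equiv.sumCongr g h)^[k] (Sum.inr x) = Sum.inr (h^[k] x) := by
    induction k with
    | zero => rfl
    | succ k ih => rw [iterate_succ_apply', ih, iterate_succ_apply']; rfl
  simp [IsPeriodicPt, IsFixedPt, this]

theorem card_minimalPeriod_sumCongr {α β : Type*} [Fintype α] [Fintype β] (g : Perm α)
    (h : Perm β) (a : ℕ) :
    (Finset.univ.filter fun x => minimalPeriod (Equiv.sumCongr g h) x = a).card =
      (Finset.univ.filter fun x => minimalPeriod g x = a).card +
        (Finset.univ.filter fun x => minimalPeriod h x = a).card := by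
  simp only [Finset.card_filter, Fintype.sum_sum_type, minimalPeriod_sumCongr_inl,
    minimalPeriod_sumCongr_inr]

theorem card_minimalPeriod_addRight {L a : ℕ} [NeZero L] (ha : a ∣ L) (b : ℕ) :
    (Finset.univ.filter fun x => minimalPeriod (Equiv.addRight ((L / a : ℕ) : ZMod L)) x = b).card =
      b * (Multiset.replicate (L / a) a).count b := by
  simp only [minimalPeriod_addRight (NeZero.pos L) ha, Multiset.count_replicate]
  split_ifs with h
  · subst h
    rw [Finset.filter_true_of_mem fun _ _ => rfl, Finset.card_univ, ZMod.card,
      Nat.mul_div_cancel' ha]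
  · rw [Finset.filter_false_of_mem fun _ _ => h]
    simp

/-- A block `(a, b)` is realized by two rotations of `ZMod (lcm a b)`. -/
theorem IsDecomp.exists_commute {T : ℕ × ℕ → Bool} {D : Multiset (ℕ × ℕ)} {n : ℕ}
    {p : Multiset ℕ × Multiset ℕ} (hD : IsDecomp T D n p) :
    ∃ (α : Type) (_ : Fintype α) (g h : Perm α), Fintype.card α = n ∧ Commute g h ∧
      (∀ a, (Finset.univ.filter fun x => minimalPeriod g x = a).card = a * p.1.count a) ∧
      ∀ a, (Finset.univ.filter fun x => minimalPeriod h x = a).card = a * p.2.count a := by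
  induction D using Multiset.induction generalizing n p with
  | empty =>
    obtain ⟨-, h2, h3⟩ := hD
    simp at h2 h3
    subst h2 h3
    exact ⟨Empty, inferInstance, 1, 1, rfl, Commute.refl _, by simp, by simp⟩
  | cons t D ih =>
    obtain ⟨m, q, rfl, rfl, hq⟩ := hD.exists_erase (Multiset.mem_cons_self t D)
    rw [Multiset.erase_cons_head] at hq
    obtain ⟨α, _, g, h, hm, hc, hg, hh⟩ := ih hq
    have hL := blockSize_pos (hD.1 t (Multiset.mem_cons_self t D)).2
    have : NeZero (blockSize t) := ⟨hL.ne'⟩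
    refine ⟨ZMod (blockSize t) ⊕ α, inferInstance,
      Equiv.sumCongr (Equiv.addRight ((blockSize t / t.1 : ℕ) : ZMod (blockSize t))) g,
      Equiv.sumCongr (Equiv.addRight ((blockSize t / t.2 : ℕ) : ZMod (blockSize t))) h,
      ?_, ?_, fun a => ?_, fun a => ?_⟩
    · rw [Fintype.card_sum, ZMod.card, hm]
    · ext x
      rcases x with x | x
      · simp [add_comm]
      · have := congrArg (fun f : Perm α => f x) hc.eq
        simpa using this
    · rw [card_minimalPeriod_sumCongr, hg,
        card_minimalPeriod_addRight (L := blockSize t) (Nat.dvd_lcm_left _ _),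
        Prod.fst_add, Multiset.count_add, mul_add]
      rfl
    · rw [card_minimalPeriod_sumCongr, hh,
        card_minimalPeriod_addRight (L := blockSize t) (Nat.dvd_lcm_right _ _),
        Prod.snd_add, Multiset.count_add, mul_add]
      rfl

theorem minimalPeriod_permCongr {α β : Type*} (e : α ≃ β) (g : Perm α) (x : β) :
    minimalPeriod (e.permCongr g) x = minimalPeriod g (e.symm x) := by
  rw [minimalPeriod_eq_minimalPeriod_iff]
  intro k
  have : (e.permCongr g)^[k] x = e (g^[k] (e.symm x)) := by
    induction k with
    | zero => simp
    | succ k ih => rw [iterate_succ_apply', ih, iterate_succ_apply']; simp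
  simp only [IsPeriodicPt, IsFixedPt, this, Equiv.eq_symm_apply]

theorem card_minimalPeriod_permCongr {α β : Type*} [Fintype α] [Fintype β] (e : α ≃ β)
    (g : Perm α) (a : ℕ) :
    (Finset.univ.filter fun x => minimalPeriod (e.permCongr g) x = a).card =
      (Finset.univ.filter fun x => minimalPeriod g x = a).card := by
  refine Finset.card_bij (fun x _ => e.symm x) ?_ ?_ ?_
  · intro x hx
    simpa [minimalPeriod_permCongr] using hx
  · intro x _ y _ h
    exact e.symm.injective h
  · intro y hy
    exact ⟨e y, by simpa [minimalPeriod_permCongr] using hy, by simp⟩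

/-- Two permutations have commuting conjugates if and only if their pair of cycle types can be built
from blocks. -/
theorem haveCommutingConjugates_iff {n : ℕ} (g h : Perm (Fin n)) :
    HaveCommutingConjugates g h ↔
      (g.partition.parts, h.partition.parts) ∈ blockPairs (fun _ => true) n := by
  constructor
  · rintro ⟨a, b, ha, hb, hab⟩
    rw [Perm.partition_eq_of_isConj.1 ha, Perm.partition_eq_of_isConj.1 hb]
    exact isDecomp_of_commute hab (Fintype.card_fin n)
  · rintro ⟨D, hD⟩
    obtain ⟨α, _, a, b, hn, hc, ha, hb⟩ := hD.exists_commute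
    let e : α ≃ Fin n := Fintype.equivFinOfCardEq hn
    refine ⟨e.permCongr a, e.permCongr b, ?_, ?_, ?_⟩
    · rw [Perm.partition_eq_of_isConj, Nat.Partition.ext_iff]
      symm
      rw [parts_partition_eq_iff _ _ fun i hi => g.partition.parts_pos hi]
      exact fun i => by rw [card_minimalPeriod_permCongr]; exact ha i
    · rw [Perm.partition_eq_of_isConj, Nat.Partition.ext_iff]
      symm
      rw [parts_partition_eq_iff _ _ fun i hi => h.partition.parts_pos hi]
      exact fun i => by rw [card_minimalPeriod_permCongr]; exact hb i
    · have := hc.map (e.permCongrHom : Perm α →* Perm (Fin n))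
      exact this

/-- Cauchy's formula for the number of permutations with a given cycle type. -/
theorem card_parts_eq {n : ℕ} {s : Multiset ℕ} (hs : ∀ a ∈ s, 0 < a) (hn : s.sum = n) :
    ((Finset.univ.filter fun g : Perm (Fin n) => g.partition.parts = s).card : ℝ) =
      n.factorial * wt s := by
  set m := s.filter fun a => 2 ≤ a with hm
  have hm1 : s.filter (fun a => ¬ 2 ≤ a) = Multiset.replicate (n - m.sum) 1 := by
    have h1 : s.filter (fun a => ¬ 2 ≤ a) =
        Multiset.replicate (s.filter (fun a => ¬ 2 ≤ a)).card 1 := by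
      rw [Multiset.eq_replicate]
      refine ⟨rfl, fun a ha => ?_⟩
      rw [Multiset.mem_filter] at ha
      have := hs a ha.1
      omega
    have h2 := Multiset.filter_add_not (fun a => 2 ≤ a) s
    rw [h1] at h2
    have h3 := congrArg Multiset.sum h2
    rw [Multiset.sum_add, hn, Multiset.sum_replicate, smul_eq_mul, mul_one, ← hm] at h3
    rw [h1]
    congr 1
    omega
  have hsum : m + Multiset.replicate (n - m.sum) 1 = s := by
    rw [← hm1, hm]
    exact Multiset.filter_add_not _ s
  have hle : m.sum ≤ n := by
    rw [← hn, ← hsum, Multiset.sum_add]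
    exact Nat.le_add_right _ _
  have hzee : zee s = (n - m.sum).factorial * m.prod * ∏ a ∈ m.toFinset, (m.count a).factorial := by
    have h1 : m.count 1 = 0 := by
      rw [Multiset.count_eq_zero, hm, Multiset.mem_filter]
      omega
    conv_lhs => rw [← hsum]
    rw [zee_add_replicate, h1, zero_add, Nat.choose_self, zee_replicate, zee]
    ring
  have hset : (Finset.univ.filter fun g : Perm (Fin n) => g.partition.parts = s) =
      Finset.univ.filter fun g : Perm (Fin n) => g.cycleType = m := by
    ext g
    simp only [Finset.mem_filter, Finset.mem_univ, true_and]
    constructor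
    · intro h
      rw [← Perm.filter_parts_partition_eq_cycleType, h]
    · intro h
      rw [Perm.parts_partition, ← Perm.sum_cycleType, h, Fintype.card_fin, hsum]
  have hcard := Perm.card_of_cycleType_mul_eq (Fin n) m
  rw [Fintype.card_fin, if_pos ⟨hle, fun a ha => (Multiset.mem_filter.1 ha).2⟩, ← hzee] at hcard
  have hz := zee_pos hs
  rw [hset, wt, ← hcard]
  push_cast
  field_simp

theorem rho_perm_eq (n : ℕ) : rho (Perm (Fin n)) = blockProb (fun _ => true) n := by
  classical
  set S := (finite_blockPairs (fun _ => true) n).toFinset with hS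
  have h1 : Nat.card {p : Perm (Fin n) × Perm (Fin n) // HaveCommutingConjugates p.1 p.2} =
      ∑ q ∈ S, (Finset.univ.filter fun g : Perm (Fin n) => g.partition.parts = q.1).card *
        (Finset.univ.filter fun g : Perm (Fin n) => g.partition.parts = q.2).card := by
    rw [Nat.card_eq_fintype_card, Fintype.card_subtype]
    rw [Finset.card_eq_sum_card_fiberwise (t := S)
      (f := fun p => (p.1.partition.parts, p.2.partition.parts))]
    · refine Finset.sum_congr rfl fun q hq => ?_
      rw [← Finset.card_product]
      congr 1
      ext p
      simp only [Finset.mem_filter, Finset.mem_univ, true_and, Finset.mem_product]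
      constructor
      · rintro ⟨-, rfl⟩
        exact ⟨rfl, rfl⟩
      · rintro ⟨e1, e2⟩
        rw [haveCommutingConjugates_iff, e1, e2]
        exact ⟨by simpa [hS] using hq, rfl⟩
    · intro p hp
      have := (haveCommutingConjugates_iff _ _).1 (Finset.mem_filter.1 hp).2
      simpa [hS] using this
  have h2 : (Nat.card (Perm (Fin n) × Perm (Fin n)) : ℝ) = n.factorial * n.factorial := by
    rw [Nat.card_prod, Nat.card_eq_fintype_card, Fintype.card_perm, Fintype.card_fin]
    push_cast
    rfl
  have h3 : (n.factorial : ℝ) ≠ 0 := by exact_mod_cast n.factorial_ne_zero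
  rw [rho, h1, h2, blockProb, div_eq_iff (mul_ne_zero h3 h3), Finset.sum_mul]
  push_cast
  refine Finset.sum_congr rfl fun q hq => ?_
  obtain ⟨D, hD⟩ : q ∈ blockPairs (fun _ => true) n := by simpa [hS] using hq
  rw [card_parts_eq hD.pos.1 hD.sum_eq.1, card_parts_eq hD.pos.2 hD.sum_eq.2]
  ring

end

/-! ### Enumerating the pairs built from small blocks -/

/-- The blocks whose cycle lengths are at most `k`. -/
def smallBlock (k : ℕ) (t : ℕ × ℕ) : Bool := decide (t.1 ≤ k) && decide (t.2 ≤ k)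

/-- The list of all partitions of `n` with parts at most `k`. -/
def partList : ℕ → ℕ → List (Multiset ℕ)
  | 0, n => if n = 0 then [0] else []
  | k + 1, n => (List.range (n / (k + 1) + 1)).flatMap fun M =>
      (partList k (n - M * (k + 1))).map (Multiset.replicate M (k + 1) + ·)

theorem mem_partList {k n : ℕ} {s : Multiset ℕ} :
    s ∈ partList k n ↔ (∀ a ∈ s, 0 < a ∧ a ≤ k) ∧ s.sum = n := by
  induction k generalizing n s with
  | zero =>
    rw [partList]
    constructor
    · intro h
      split_ifs at h with hn
      · rw [List.mem_singleton] at h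
        subst h hn
        simp
      · simp at h
    · rintro ⟨h1, h2⟩
      have : s = 0 := Multiset.eq_zero_of_forall_notMem fun a ha => by
        have := h1 a ha
        omega
      subst this
      simp at h2
      simp [← h2]
  | succ k ih =>
    simp only [partList, List.mem_flatMap, List.mem_map, List.mem_range]
    constructor
    · rintro ⟨M, hM, u, hu, rfl⟩
      obtain ⟨h1, h2⟩ := ih.1 hu
      have hle : M * (k + 1) ≤ n :=
        (Nat.le_div_iff_mul_le (Nat.succ_pos k)).1 (Nat.lt_succ_iff.1 hM)
      refine ⟨fun a ha => ?_, ?_⟩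
      · rcases Multiset.mem_add.1 ha with ha | ha
        · have := Multiset.eq_of_mem_replicate ha
          omega
        · have := h1 a ha
          omega
      · rw [Multiset.sum_add, h2, Multiset.sum_replicate, smul_eq_mul]
        omega
    · rintro ⟨h1, h2⟩
      have hs : Multiset.replicate (s.count (k + 1)) (k + 1) + s.filter (fun a => ¬ k + 1 = a) =
          s := by
        rw [← Multiset.filter_eq]
        exact Multiset.filter_add_not _ s
      have hsum := congrArg Multiset.sum hs
      rw [Multiset.sum_add, Multiset.sum_replicate, smul_eq_mul, h2] at hsum
      refine ⟨s.count (k + 1), ?_, s.filter (fun a => ¬ k + 1 = a), ih.2 ⟨fun a ha => ?_, ?_⟩, hs⟩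
      · rw [Nat.lt_succ_iff, Nat.le_div_iff_mul_le (Nat.succ_pos k), ← hsum]
        exact Nat.le_add_right _ _
      · rw [Multiset.mem_filter] at ha
        have := h1 a ha.1
        omega
      · omega

theorem nodup_partList (k n : ℕ) : (partList k n).Nodup := by
  induction k generalizing n with
  | zero => rw [partList]; split_ifs <;> simp
  | succ k ih =>
    rw [partList, List.nodup_flatMap]
    refine ⟨fun M _ => (ih _).map (add_right_injective _), ?_⟩
    refine List.nodup_range.imp_of_mem ?_
    intro M M' _ _ hne
    simp only [Function.onFun, List.disjoint_left, List.mem_map]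
    rintro s ⟨u, hu, rfl⟩ ⟨u', hu', he⟩
    have hc := congrArg (Multiset.count (k + 1)) he
    have h0 : ∀ {u m}, u ∈ partList k m → u.count (k + 1) = 0 := by
      intro u m hu
      refine Multiset.count_eq_zero_of_notMem fun h => ?_
      have := (mem_partList.1 hu).1 _ h
      omega
    rw [Multiset.count_add, Multiset.count_add, Multiset.count_replicate_self,
      Multiset.count_replicate_self, h0 hu, h0 hu'] at hc
    exact hne (by omega)

/-- `force x F` is `F x`; the case distinction makes the kernel evaluate `x` first. -/
def force {β : Type*} (x : ℕ) (F : ℕ → β) : β :=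
  match x with
  | 0 => F 0
  | y + 1 => F (Nat.succ y)

theorem force_eq {β : Type*} (x : ℕ) (F : ℕ → β) : force x F = F x := by cases x <;> rfl

/-- Adds one copy after another of the part `a` to a partition of which `m` points remain to be
filled, and continues with `rest`. The list `gs` holds the states after adding `0, 1, 2, …` copies,
the latest one first, and `z` is the centralizer order so far. -/
def enumLoop {β : Type*} (step : ℕ → List ℕ → ℕ) (rest : ℕ → ℕ → ℕ → List β) (a : ℕ) :
    ℕ → ℕ → List ℕ → ℕ → List β
  | 0, m, gs, z => rest m (gs.headD 0) z
  | f + 1, m, gs, z => rest m (gs.headD 0) z ++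
      bif Nat.ble a m then
        force (step a gs) fun g => force (m - a) fun m' => force (z * (a * gs.length)) fun z' =>
          enumLoop step rest a f m' (g :: gs) z'
      else []

/-- Depth-first traversal of the partitions of `n` with parts at most `k`, updating a state with
each part and collecting the values of `leaf`. -/
def enum {β : Type*} (step : ℕ → List ℕ → ℕ) (leaf : ℕ → ℕ → β) : ℕ → ℕ → ℕ → ℕ → List β
  | 0, n, g, z => bif Nat.beq n 0 then [leaf g z] else []
  | k + 1, n, g, z => enumLoop step (enum step leaf k) (k + 1) n n [g] z

section

variable {β : Type*} {step : ℕ → List ℕ → ℕ} {R : Multiset ℕ → ℕ → Prop}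

/-- The list of states `gs` is correct for `s` with `gs.length - 1, …, 1, 0` additional copies of
`a`. -/
def StatesFor (R : Multiset ℕ → ℕ → Prop) (s : Multiset ℕ) (a : ℕ) (gs : List ℕ) : Prop :=
  ∀ i < gs.length, R (s + Multiset.replicate (gs.length - 1 - i) a) (gs.getD i 0)

theorem enumLoop_eq {K : ℕ}
    (hstep : ∀ s a gs, 0 < a → a ≤ K → s.count a = 0 → gs ≠ [] → StatesFor R s a gs →
      R (s + Multiset.replicate gs.length a) (step a gs))
    {rest : ℕ → ℕ → ℕ → List β} {val : Multiset ℕ → ℕ → List β} {a : ℕ} (ha : 0 < a) (haK : a ≤ K)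
    {s : Multiset ℕ} (hs : s.count a = 0)
    (hrest : ∀ m g M, R (s + Multiset.replicate M a) g →
      rest m g (zee (s + Multiset.replicate M a)) = val (s + Multiset.replicate M a) m)
    (f m : ℕ) (gs : List ℕ) (M : ℕ) (hlen : gs.length = M + 1) (hgs : StatesFor R s a gs)
    (hf : m ≤ f) :
    enumLoop step rest a f m gs (zee (s + Multiset.replicate M a)) =
      (List.range (m / a + 1)).flatMap fun i =>
        val (s + Multiset.replicate (M + i) a) (m - i * a) := by
  have hne : gs ≠ [] := by rintro rfl; simp at hlen
  have hhead : R (s + Multiset.replicate M a) (gs.headD 0) := by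
    have := hgs 0 (by omega)
    rw [show gs.length - 1 - 0 = M by omega] at this
    cases gs with
    | nil => exact absurd rfl hne
    | cons g gs => simpa using this
  induction f generalizing m gs M with
  | zero =>
    have hm : m = 0 := by omega
    subst hm
    rw [enumLoop, hrest _ _ _ hhead]
    simp
  | succ f ih =>
    rw [enumLoop, hrest _ _ _ hhead]
    simp only [force_eq]
    rw [List.range_succ_eq_map, List.flatMap_cons, zero_mul, Nat.sub_zero, Nat.add_zero]
    congr 1
    by_cases ham : a ≤ m
    · rw [show Nat.ble a m = true from Nat.ble_eq_true_of_le ham, cond_true]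
      have hz : zee (s + Multiset.replicate M a) * (a * gs.length) =
          zee (s + Multiset.replicate (M + 1) a) := by
        rw [zee_add_replicate, zee_add_replicate, hs, zee_replicate, zee_replicate, hlen, zero_add,
          zero_add, Nat.choose_self, Nat.choose_self, Nat.factorial_succ, pow_succ]
        ring
      have hnew : R (s + Multiset.replicate (M + 1) a) (step a gs) := by
        rw [← hlen]
        exact hstep s a gs ha haK hs hne hgs
      rw [hz, ih (m - a) (step a gs :: gs) (M + 1) (by simp [hlen]) ?_ (by omega) (by simp)
        (by simpa using hnew)]
      · rw [List.flatMap_map, show m / a = (m - a) / a + 1 by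
          rw [Nat.div_eq_sub_div ha ham]]
        refine List.flatMap_congr fun i _ => ?_
        rw [Nat.sub_sub, Nat.succ_mul, Nat.succ_eq_add_one, Nat.add_comm a, Nat.add_assoc M 1 i,
          Nat.add_comm 1 i]
      · intro i hi
        cases i with
        | zero => simpa [hlen] using hnew
        | succ i =>
          have := hgs i (by simpa using hi)
          simpa [Nat.sub_sub, Nat.add_comm 1 i] using this
    · rw [show Nat.ble a m = false by
        rw [Bool.eq_false_iff, Ne, Nat.ble_eq]; exact ham, cond_false, Nat.div_eq_of_lt (by omega)]
      simp

/-- If `step` keeps the invariant `R` between partitions and states, then `enum` computes a list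
indexed by `partList`. -/
theorem enum_eq {K : ℕ}
    (hstep : ∀ s a gs, 0 < a → a ≤ K → s.count a = 0 → gs ≠ [] → StatesFor R s a gs →
      R (s + Multiset.replicate gs.length a) (step a gs))
    {leaf : ℕ → ℕ → β} {val : Multiset ℕ → β} (hleaf : ∀ s g, R s g → leaf g (zee s) = val s)
    (k n : ℕ) (hk : k ≤ K) (s : Multiset ℕ) (hs : ∀ a ∈ s, k < a) (g : ℕ) (hg : R s g) :
    enum step leaf k n g (zee s) = (partList k n).map fun u => val (s + u) := by
  induction k generalizing n s g with
  | zero =>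
    rw [enum, partList, hleaf s g hg]
    by_cases hn : n = 0
    · subst hn; simp
    · have h0 : Nat.beq n 0 = false := by
        rw [Bool.eq_false_iff, Ne, Nat.beq_eq]
        exact hn
      rw [h0, cond_false, if_neg hn]
      rfl
  | succ k ih =>
    have hc : s.count (k + 1) = 0 :=
      Multiset.count_eq_zero_of_notMem fun h => lt_irrefl _ (hs _ h)
    have h := enumLoop_eq (β := β) hstep (rest := enum step leaf k)
      (val := fun s m => (partList k m).map fun u => val (s + u)) (Nat.succ_pos k) hk hc
      (fun m g M hR => ih m (Nat.le_of_succ_le hk) _ (fun a ha => ?_) g hR) n n [g] 0 rfl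
      (fun i hi => ?_) le_rfl
    · rw [enum, partList, List.map_flatMap]
      simp only [Multiset.replicate_zero, add_zero, zero_add] at h
      rw [h]
      refine List.flatMap_congr fun M _ => ?_
      rw [List.map_map]
      refine List.map_congr_left fun u _ => ?_
      simp [add_assoc]
    · rcases Multiset.mem_add.1 ha with ha | ha
      · exact (hs a ha).trans' (Nat.lt_succ_self k)
      · rw [Multiset.eq_of_mem_replicate ha]; exact Nat.lt_succ_self k
    · have : i = 0 := by simpa using hi
      subst this
      simpa using hg

end

/-- A numerical code for partitions. Adding parts to a partition translates its code. The summand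
`(a - 1) ^ e` of a part `a` vanishes for fixed points, which keeps the codes small. The code need
not determine the partition. -/
def code (e : ℕ) (s : Multiset ℕ) : ℕ := (s.map fun a => (a - 1) ^ e).sum

theorem code_add (e : ℕ) (s t : Multiset ℕ) : code e (s + t) = code e s + code e t := by
  simp [code]

theorem code_replicate (e j a : ℕ) : code e (Multiset.replicate j a) = j * (a - 1) ^ e := by
  simp [code]

/-- The bits of `x` are the codes of the partitions `t` such that `(s, t)` can be built from blocks
with cycle lengths at most `k`. -/
def IsMask (e k : ℕ) (s : Multiset ℕ) (x : ℕ) : Prop :=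
  ∀ c, x.testBit c = true ↔ ∃ t m D, code e t = c ∧ IsDecomp (smallBlock k) D m (s, t)

/-- The mask for one more part `a`, computed from the masks `gs` for fewer copies of `a`: some part
`a` belongs to a block `(a, b)`, and removing it leaves one of the earlier cases. -/
def maskStep (e a : ℕ) (gs : List ℕ) : ℕ → ℕ
  | 0 => 0
  | b + 1 => maskStep e a gs b |||
      (gs.getD (Nat.lcm a (b + 1) / a - 1) 0) <<< (Nat.lcm a (b + 1) / (b + 1) * b ^ e)

theorem testBit_maskStep (e a : ℕ) (gs : List ℕ) (k c : ℕ) :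
    (maskStep e a gs k).testBit c = true ↔ ∃ b, 0 < b ∧ b ≤ k ∧
      Nat.lcm a b / b * (b - 1) ^ e ≤ c ∧
      (gs.getD (Nat.lcm a b / a - 1) 0).testBit (c - Nat.lcm a b / b * (b - 1) ^ e) = true := by
  induction k with
  | zero =>
    simp only [maskStep, Nat.zero_testBit, Bool.false_eq_true, false_iff]
    rintro ⟨b, h1, h2, -⟩
    omega
  | succ k ih =>
    rw [maskStep, Nat.testBit_or, Bool.or_eq_true, ih, Nat.testBit_shiftLeft, Bool.and_eq_true,
      decide_eq_true_eq]
    constructor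
    · rintro (⟨b, h1, h2, h3⟩ | h)
      · exact ⟨b, h1, by omega, h3⟩
      · exact ⟨k + 1, by omega, le_rfl, h⟩
    · rintro ⟨b, h1, h2, h3⟩
      rcases Nat.lt_or_ge b (k + 1) with h | h
      · exact Or.inl ⟨b, h1, by omega, h3⟩
      · obtain rfl : b = k + 1 := by omega
        exact Or.inr h3

theorem isMask_zero (e k : ℕ) : IsMask e k 0 1 := by
  intro c
  rw [show (1 : ℕ) = 2 ^ 0 from rfl, Nat.testBit_two_pow]
  simp only [decide_eq_true_eq]
  constructor
  · rintro rfl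
    exact ⟨0, 0, 0, by simp [code], isDecomp_zero⟩
  · rintro ⟨t, m, D, rfl, hD⟩
    have h0 := hD.sum_eq
    simp only [Multiset.sum_zero] at h0
    have : t = 0 := by
      refine Multiset.eq_zero_of_forall_notMem fun a ha => ?_
      have h1 := hD.pos.2 a ha
      have h2 := Multiset.le_sum_of_mem ha
      omega
    subst this
    simp [code]

theorem IsDecomp.exists_mem {T : ℕ × ℕ → Bool} {D : Multiset (ℕ × ℕ)} {n : ℕ}
    {p : Multiset ℕ × Multiset ℕ} (h : IsDecomp T D n p) {a : ℕ} (ha : a ∈ p.1) :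
    ∃ t ∈ D, t.1 = a := by
  induction D using Multiset.induction generalizing n p with
  | empty =>
    obtain ⟨-, -, h3⟩ := h
    simp at h3
    subst h3
    simp at ha
  | cons t D ih =>
    obtain ⟨m, q, rfl, rfl, hq⟩ := h.exists_erase (Multiset.mem_cons_self t D)
    rw [Multiset.erase_cons_head] at hq
    rcases Multiset.mem_add.1 ha with ha | ha
    · exact ⟨t, Multiset.mem_cons_self _ _, (Multiset.eq_of_mem_replicate ha).symm⟩
    · obtain ⟨u, hu, hua⟩ := ih hq ha
      exact ⟨u, Multiset.mem_cons_of_mem hu, hua⟩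

theorem IsDecomp.exists_mem_snd {T : ℕ × ℕ → Bool} {D : Multiset (ℕ × ℕ)} {n : ℕ}
    {p : Multiset ℕ × Multiset ℕ} (h : IsDecomp T D n p) {a : ℕ} (ha : a ∈ p.2) :
    ∃ t ∈ D, t.2 = a := by
  induction D using Multiset.induction generalizing n p with
  | empty =>
    obtain ⟨-, -, h3⟩ := h
    simp at h3
    subst h3
    simp at ha
  | cons t D ih =>
    obtain ⟨m, q, rfl, rfl, hq⟩ := h.exists_erase (Multiset.mem_cons_self t D)
    rw [Multiset.erase_cons_head] at hq
    rcases Multiset.mem_add.1 ha with ha | ha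
    · exact ⟨t, Multiset.mem_cons_self _ _, (Multiset.eq_of_mem_replicate ha).symm⟩
    · obtain ⟨u, hu, hua⟩ := ih hq ha
      exact ⟨u, Multiset.mem_cons_of_mem hu, hua⟩

theorem IsDecomp.mem_partList {k n : ℕ} {D : Multiset (ℕ × ℕ)} {p : Multiset ℕ × Multiset ℕ}
    (h : IsDecomp (smallBlock k) D n p) : p.1 ∈ partList k n ∧ p.2 ∈ partList k n := by
  have hk : ∀ t ∈ D, t.1 ≤ k ∧ t.2 ≤ k := by
    intro t ht
    simpa [smallBlock] using (h.1 t ht).1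
  rw [_root_.mem_partList, _root_.mem_partList]
  refine ⟨⟨fun a ha => ⟨h.pos.1 a ha, ?_⟩, h.sum_eq.1⟩, fun a ha => ⟨h.pos.2 a ha, ?_⟩, h.sum_eq.2⟩
  · obtain ⟨t, ht, rfl⟩ := h.exists_mem ha
    exact (hk t ht).1
  · obtain ⟨t, ht, rfl⟩ := h.exists_mem_snd ha
    exact (hk t ht).2

theorem blockProb_eq_smallBlock {k n : ℕ} (h : n ≤ k) :
    blockProb (fun _ => true) n = blockProb (smallBlock k) n := by
  have : blockPairs (fun _ => true) n = blockPairs (smallBlock k) n := by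
    ext p
    constructor
    · rintro ⟨D, hD⟩
      refine ⟨D, fun t ht => ⟨?_, (hD.1 t ht).2⟩, hD.2⟩
      have h1 : blockSize t ≤ n := by
        rw [← hD.2.1]
        exact Multiset.le_sum_of_mem (Multiset.mem_map_of_mem _ ht)
      have h2 := blockSize_pos (hD.1 t ht).2
      have h3 : t.1 ≤ blockSize t := Nat.le_of_dvd h2 (Nat.dvd_lcm_left _ _)
      have h4 : t.2 ≤ blockSize t := Nat.le_of_dvd h2 (Nat.dvd_lcm_right _ _)
      simp only [smallBlock, Bool.and_eq_true, decide_eq_true_eq]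
      omega
    · rintro ⟨D, hD⟩
      exact ⟨D, fun t ht => ⟨rfl, (hD.1 t ht).2⟩, hD.2⟩
  unfold blockProb
  congr 1
  simp only [this]

theorem isMask_step (e k : ℕ) (s : Multiset ℕ) (a : ℕ) (gs : List ℕ) (ha : 0 < a) (hak : a ≤ k)
    (hs : s.count a = 0) (hne : gs ≠ []) (hgs : StatesFor (IsMask e k) s a gs) :
    IsMask e k (s + Multiset.replicate gs.length a) (maskStep e a gs k) := by
  have hlen : 0 < gs.length := List.length_pos_iff.2 hne
  intro c
  rw [testBit_maskStep]
  constructor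
  · rintro ⟨b, hb, hbk, hc, hbit⟩
    set j := Nat.lcm a b / a with hj
    have hj0 : 0 < j := Nat.div_pos (Nat.le_of_dvd (Nat.lcm_pos ha hb) (Nat.dvd_lcm_left _ _)) ha
    have hjl : j - 1 < gs.length := by
      by_contra hcon
      rw [List.getD_eq_default _ _ (by omega)] at hbit
      simp at hbit
    obtain ⟨t, m, D, ht, hD⟩ := (hgs (j - 1) hjl _).1 hbit
    have := isDecomp_cons (t := (a, b)) ⟨by simp [smallBlock, hak, hbk], ha, hb⟩ hD
    refine ⟨Multiset.replicate (Nat.lcm a b / b) b + t, blockSize (a, b) + m, (a, b) ::ₘ D,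
      ?_, ?_⟩
    · rw [code_add, code_replicate, ht]
      exact Nat.add_sub_cancel' hc
    · convert this using 1
      refine Prod.ext ?_ rfl
      change _ = Multiset.replicate j a + (s + Multiset.replicate (gs.length - 1 - (j - 1)) a)
      rw [add_left_comm, ← Multiset.replicate_add,
        show j + (gs.length - 1 - (j - 1)) = gs.length by omega]
  · rintro ⟨t, m, D, rfl, hD⟩
    obtain ⟨⟨a', b⟩, hu, hua⟩ := hD.exists_mem (a := a)
      (Multiset.mem_add.2 (Or.inr (Multiset.mem_replicate.2 ⟨hlen.ne', rfl⟩)))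
    dsimp only at hua
    subst hua
    obtain ⟨hU, -, hb⟩ := hD.1 _ hu
    dsimp only at hb
    simp only [smallBlock, Bool.and_eq_true, decide_eq_true_eq] at hU
    obtain ⟨m', q, rfl, hq, hD'⟩ := hD.exists_erase hu
    have hq1 : s + Multiset.replicate gs.length a' =
        Multiset.replicate (Nat.lcm a' b / a') a' + q.1 := congrArg Prod.fst hq
    have hq2 : t = Multiset.replicate (Nat.lcm a' b / b) b + q.2 := congrArg Prod.snd hq
    set j := Nat.lcm a' b / a' with hj
    have hj0 : 0 < j := Nat.div_pos (Nat.le_of_dvd (Nat.lcm_pos ha hb) (Nat.dvd_lcm_left _ _)) ha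
    have hcount := congrArg (Multiset.count a') hq1
    rw [Multiset.count_add, Multiset.count_add, hs, Multiset.count_replicate_self,
      Multiset.count_replicate_self] at hcount
    have hq3 : q.1 = s + Multiset.replicate (gs.length - 1 - (j - 1)) a' := by
      rw [show gs.length = j + (gs.length - 1 - (j - 1)) by omega, Multiset.replicate_add,
        add_left_comm] at hq1
      exact (add_left_cancel hq1).symm
    refine ⟨b, hb, hU.2, ?_, ?_⟩
    · rw [hq2, code_add, code_replicate]
      exact Nat.le_add_right _ _
    · rw [hgs (j - 1) (by omega)]
      refine ⟨q.2, m', D.erase (a', b), ?_, ?_⟩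
      · rw [hq2, code_add, code_replicate, Nat.add_sub_cancel_left]
      · rw [← hq3]
        exact hD'

/-- The sum of the second components of the pairs in a list whose first component is the position of
a bit of `x`. The operations on `ℕ` are written without type classes to speed up evaluation in the
kernel. -/
def bitSum (x : ℕ) : List (ℕ × ℕ) → ℕ
  | [] => 0
  | y :: l => Nat.add (Nat.mul (Nat.mod (Nat.shiftRight x y.1) 2) y.2) (bitSum x l)

theorem bitSum_eq (x : ℕ) (l : List (ℕ × ℕ)) :
    bitSum x l = (l.map fun y => if x.testBit y.1 = true then y.2 else 0).sum := by
  induction l with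
  | nil => rfl
  | cons y l ih =>
    rw [List.map_cons, List.sum_cons, ← ih, bitSum]
    change (x >>> y.1) % 2 * y.2 + bitSum x l = _
    rw [Nat.testBit_eq_decide_div_mod_eq, Nat.shiftRight_eq_div_pow]
    congr 1
    rcases Nat.mod_two_eq_zero_or_one (x / 2 ^ y.1) with h | h <;> simp [h]

/-- `forceList l F` is `F l`; the kernel evaluates the entries of `l` first. -/
def forceList {β : Type*} : List (ℕ × ℕ) → (List (ℕ × ℕ) → β) → β
  | [], F => F []
  | y :: l, F => force y.1 fun c => force y.2 fun w => forceList l fun l' => F ((c, w) :: l')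

theorem forceList_eq {β : Type*} (l : List (ℕ × ℕ)) (F : List (ℕ × ℕ) → β) :
    forceList l F = F l := by
  induction l generalizing F with
  | nil => rfl
  | cons y l ih => rw [forceList, force_eq, force_eq, ih]

/-- The list of the codes of all partitions of `n` with parts at most `k`, with the values of `ω` at
their centralizer orders. -/
def codeList (ω : ℕ → ℕ) (e k n : ℕ) : List (ℕ × ℕ) :=
  enum (fun a gs => gs.headD 0 + (a - 1) ^ e) (fun c z => (c, ω z)) k n 0 1

/-- `enumPairs ω e k n` is the sum of `ω (zee s) * ω (zee t)` over the pairs of partitions of `n`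
with parts at most `k` such that the mask of `s` contains the code of `t`. -/
def enumPairs (ω : ℕ → ℕ) (e k n : ℕ) : ℕ :=
  forceList (codeList ω e k n) fun P =>
    (enum (fun a gs => maskStep e a gs k) (fun x z => force x fun y => ω z * bitSum y P)
      k n 1 1).sum

theorem zee_zero : zee 0 = 1 := by simp [zee]

theorem codeList_eq (ω : ℕ → ℕ) (e k n : ℕ) :
    codeList ω e k n = (partList k n).map fun t => (code e t, ω (zee t)) := by
  have h := enum_eq (β := ℕ × ℕ) (step := fun a gs => gs.headD 0 + (a - 1) ^ e)
    (R := fun s c => code e s = c) (K := k) ?_ (leaf := fun c z => (c, ω z))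
    (val := fun t => (code e t, ω (zee t))) ?_ k n le_rfl 0 (by simp) 0 (by simp [code])
  · rw [zee_zero] at h
    rw [codeList, h]
    simp
  · intro s a gs _ _ _ hne hgs
    have hlen : 0 < gs.length := List.length_pos_iff.2 hne
    have := hgs 0 hlen
    cases gs with
    | nil => exact absurd rfl hne
    | cons g gs =>
      simp only [code_add, code_replicate, List.length_cons, List.headD_cons] at this ⊢
      simp only [Nat.add_sub_cancel, Nat.sub_zero, List.getD_cons_zero] at this
      rw [← this]
      ring
  · rintro s g rfl
    rfl

open Classical in
theorem enumPairs_eq (ω : ℕ → ℕ) (e k n : ℕ) :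
    enumPairs ω e k n = ∑ s ∈ (partList k n).toFinset, ∑ t ∈ (partList k n).toFinset,
      if ∃ t' m D, code e t' = code e t ∧ IsDecomp (smallBlock k) D m (s, t') then
        ω (zee s) * ω (zee t) else 0 := by
  have h := enum_eq (β := ℕ) (step := fun a gs => maskStep e a gs k) (R := IsMask e k) (K := k)
    (fun s a gs ha hak hs hne hgs => isMask_step e k s a gs ha hak hs hne hgs)
    (leaf := fun x z => force x fun y => ω z * bitSum y (codeList ω e k n))
    (val := fun s => ∑ t ∈ (partList k n).toFinset,
      if ∃ t' m D, code e t' = code e t ∧ IsDecomp (smallBlock k) D m (s, t') then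
        ω (zee s) * ω (zee t) else 0) ?_ k n le_rfl 0 (by simp) 1 (isMask_zero e k)
  · rw [zee_zero] at h
    rw [enumPairs, forceList_eq, h, List.sum_toFinset _ (nodup_partList k n)]
    simp
  · intro s g hg
    rw [force_eq, bitSum_eq, codeList_eq, List.map_map, List.sum_toFinset _ (nodup_partList k n),
      ← List.sum_map_mul_left]
    congr 1
    refine List.map_congr_left fun t _ => ?_
    simp only [Function.comp_apply, mul_ite, mul_zero]
    exact if_congr (hg _) rfl rfl

theorem natCast_div_le_mul_wt (N : ℕ) (s : Multiset ℕ) : ((N / zee s : ℕ) : ℝ) ≤ N * wt s := by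
  rw [wt, ← div_eq_mul_inv]
  exact Nat.cast_div_le

theorem mul_wt_le_natCast_div_add_one (N : ℕ) (s : Multiset ℕ) :
    N * wt s ≤ ((N / zee s + 1 : ℕ) : ℝ) := by
  rw [wt, ← div_eq_mul_inv]
  push_cast
  have h := (Nat.lt_floor_add_one ((N : ℝ) / zee s)).le
  rwa [Nat.floor_div_eq_div] at h

/-- The enumeration gives an upper bound for the probability; partitions with the same code can only
increase the value of `enumPairs`. -/
theorem mul_blockProb_smallBlock_le (N e k n : ℕ) :
    N ^ 2 * blockProb (smallBlock k) n ≤ enumPairs (fun z => N / z + 1) e k n := by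
  classical
  rw [enumPairs_eq, blockProb, Finset.mul_sum]
  push_cast
  rw [← Finset.sum_product']
  set P := (partList k n).toFinset ×ˢ (partList k n).toFinset
  have hsub : (finite_blockPairs (smallBlock k) n).toFinset ⊆ P := by
    intro p hp
    obtain ⟨D, hD⟩ := (Set.Finite.mem_toFinset _).1 hp
    simpa [P] using hD.mem_partList
  refine le_trans ?_ (Finset.sum_le_sum_of_subset_of_nonneg hsub fun p _ _ => ?_)
  · refine Finset.sum_le_sum fun p hp => ?_
    obtain ⟨D, hD⟩ := (Set.Finite.mem_toFinset _).1 hp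
    rw [if_pos ⟨p.2, n, D, rfl, hD⟩]
    have h1 := mul_wt_le_natCast_div_add_one N p.1
    have h2 := mul_wt_le_natCast_div_add_one N p.2
    push_cast at h1 h2
    calc (N : ℝ) ^ 2 * (wt p.1 * wt p.2) = (N * wt p.1) * (N * wt p.2) := by ring
      _ ≤ _ := mul_le_mul h1 h2 (mul_nonneg N.cast_nonneg (wt_nonneg _)) (by positivity)
  · positivity

/-- If partitions are determined by their codes, then the enumeration also gives a lower bound. -/
theorem enumPairs_le_mul_blockProb {N e k n : ℕ}
    (hcode : ((codeList (fun z => N / z) e k n).map Prod.fst).Nodup) :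
    (enumPairs (fun z => N / z) e k n : ℝ) ≤ N ^ 2 * blockProb (smallBlock k) n := by
  classical
  rw [codeList_eq, List.map_map] at hcode
  have hinj := List.inj_on_of_nodup_map hcode
  rw [enumPairs_eq, blockProb, Finset.mul_sum]
  push_cast
  rw [← Finset.sum_product', ← Finset.sum_filter]
  have hsub : (((partList k n).toFinset ×ˢ (partList k n).toFinset).filter fun p =>
      ∃ t' m D, code e t' = code e p.2 ∧ IsDecomp (smallBlock k) D m (p.1, t')) ⊆
        (finite_blockPairs (smallBlock k) n).toFinset := by
    intro p hp
    simp only [Finset.mem_filter, Finset.mem_product, List.mem_toFinset] at hp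
    obtain ⟨⟨h1, h2⟩, t', m, D, hc, hD⟩ := hp
    have hm : m = n := by
      rw [← (mem_partList.1 h1).2, ← hD.sum_eq.1]
    subst hm
    have : t' = p.2 := hinj hD.mem_partList.2 h2 hc
    subst this
    rw [Set.Finite.mem_toFinset]
    exact ⟨D, hD⟩
  refine le_trans (Finset.sum_le_sum fun p _ => ?_)
    (Finset.sum_le_sum_of_subset_of_nonneg hsub fun p _ _ =>
      mul_nonneg (by positivity) (wt_mul_wt_nonneg p))
  have h1 := natCast_div_le_mul_wt N p.1
  have h2 := natCast_div_le_mul_wt N p.2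
  calc ((N / zee p.1 : ℕ) : ℝ) * ((N / zee p.2 : ℕ) : ℝ) ≤ (N * wt p.1) * (N * wt p.2) :=
        mul_le_mul h1 h2 (Nat.cast_nonneg _) (mul_nonneg N.cast_nonneg (wt_nonneg _))
    _ = _ := by ring

/-! ### Numerical bounds from the linear recursions -/

/-- `forceNats l F` is `F l`; the kernel evaluates the entries of `l` first. -/
def forceNats {β : Type*} : List ℕ → (List ℕ → β) → β
  | [], F => F []
  | y :: l, F => force y fun c => forceNats l fun l' => F (c :: l')

theorem forceNats_eq {β : Type*} (l : List ℕ) (F : List ℕ → β) : forceNats l F = F l := by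
  induction l generalizing F with
  | nil => rfl
  | cons y l ih => rw [forceNats, force_eq, ih]

/-- The scalar product of two lists, up to the length of the shorter one. -/
def dot : List ℕ → List ℕ → ℕ
  | x :: xs, y :: ys => Nat.add (Nat.mul x y) (dot xs ys)
  | _, _ => 0

theorem dot_eq_sum (xs ys : List ℕ) (n : ℕ) (hx : n ≤ xs.length) (hy : ys.length = n) :
    dot xs ys = ∑ i ∈ Finset.range n, xs.getD i 0 * ys.getD i 0 := by
  induction n generalizing xs ys with
  | zero =>
    obtain rfl := List.length_eq_zero_iff.1 hy
    cases xs <;> rfl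
  | succ n ih =>
    cases xs with
    | nil => simp at hx
    | cons x xs =>
      cases ys with
      | nil => simp at hy
      | cons y ys =>
        rw [Finset.sum_range_succ', dot, ih xs ys (by simpa using hx) (by simpa using hy)]
        simp [add_comm]

/-- The unit of the fixed-point arithmetic below. -/
def unit : ℕ := 1000000000000

/-- The divisors `a` of `m`, with the centralizer orders of `m / a` cycles of length `a`. -/
def divisorList (m : ℕ) : List (ℕ × ℕ) :=
  ((List.range (m + 1)).filter fun a => Nat.ble 1 a && Nat.beq (m % a) 0).map fun a =>
    (a, a ^ (m / a) * (m / a).factorial)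

/-- An upper bound for `recCoef T m` in fixed-point arithmetic. -/
def coefBound (T : ℕ × ℕ → Bool) (m : ℕ) : ℕ :=
  forceList (divisorList m) fun L => (L.map fun x => (L.map fun y =>
    bif Nat.beq (Nat.lcm x.1 y.1) m && T (x.1, y.1) then unit * m / (x.2 * y.2) + 1 else 0).sum).sum

theorem blockCost_eq_of_blockSize {t : ℕ × ℕ} {m : ℕ} (h : blockSize t = m) :
    blockCost t = (((t.1 ^ (m / t.1) * (m / t.1).factorial) *
      (t.2 ^ (m / t.2) * (m / t.2).factorial) : ℕ) : ℝ)⁻¹ := by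
  subst h
  simp only [blockCost, blockPair, wt_replicate]
  push_cast
  rw [← mul_inv]

theorem natCast_div_le_div_add_one (a b : ℕ) : (a : ℝ) / b ≤ ((a / b + 1 : ℕ) : ℝ) := by
  push_cast
  have h := (Nat.lt_floor_add_one ((a : ℝ) / b)).le
  rwa [Nat.floor_div_eq_div] at h

theorem mul_recCoef_le_coefBound (T : ℕ × ℕ → Bool) {m : ℕ} (hm : 0 < m) :
    unit * recCoef T m ≤ coefBound T m := by
  have hnodup : ((List.range (m + 1)).filter fun a => Nat.ble 1 a && Nat.beq (m % a) 0).Nodup :=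
    List.nodup_range.filter _
  have hset : ((List.range (m + 1)).filter fun a =>
      Nat.ble 1 a && Nat.beq (m % a) 0).toFinset = m.divisors := by
    ext a
    simp only [List.mem_toFinset, List.mem_filter, List.mem_range, Nat.mem_divisors,
      Bool.and_eq_true, Nat.ble_eq, Nat.beq_eq, Nat.dvd_iff_mod_eq_zero]
    constructor
    · exact fun h => ⟨h.2.2, hm.ne'⟩
    · intro h
      have h1 := Nat.dvd_of_mod_eq_zero h.1
      exact ⟨Nat.lt_succ_of_le (Nat.le_of_dvd hm h1), Nat.pos_of_dvd_of_pos h1 hm, h.1⟩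
  have h1 : coefBound T m = ∑ a ∈ m.divisors, ∑ b ∈ m.divisors,
      bif Nat.beq (Nat.lcm a b) m && T (a, b) then
        unit * m / ((a ^ (m / a) * (m / a).factorial) * (b ^ (m / b) * (m / b).factorial)) + 1
      else 0 := by
    simp only [coefBound, forceList_eq, divisorList, List.map_map, ← hset,
      List.sum_toFinset _ hnodup, Function.comp_def]
  rw [h1, ← Finset.sum_product', recCoef, blocksOfSize, Finset.sum_filter, Finset.mul_sum,
    Finset.mul_sum]
  push_cast
  refine Finset.sum_le_sum fun t _ => ?_
  by_cases h : blockSize t = m ∧ T t = true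
  · rw [if_pos h, show (Nat.beq (Nat.lcm t.1 t.2) m && T (t.1, t.2)) = true by
      rw [Bool.and_eq_true, Nat.beq_eq]; exact h, cond_true, blockCost_eq_of_blockSize h.1]
    refine le_trans (le_of_eq ?_) (natCast_div_le_div_add_one _ _)
    push_cast
    ring
  · rw [if_neg h, mul_zero, mul_zero]
    exact Nat.cast_nonneg _

/-- The list of the bounds `coefBound T m` for `m = 1, …, N`. -/
def coefBounds (T : ℕ × ℕ → Bool) (N : ℕ) : List ℕ :=
  (List.range N).map fun i => coefBound T (i + 1)

/-- The entries of `l`, read backwards, are upper bounds for `f 0, f 1, …` in fixed-point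
arithmetic. -/
def IsBound (f : ℕ → ℝ) (l : List ℕ) : Prop :=
  ∀ i < l.length, unit * f i ≤ l.getD (l.length - 1 - i) 0

/-- Extends a list of bounds by `k` more entries computed with the recursion of
`mul_blockProb_le`. -/
def extend (cs : List ℕ) : ℕ → List ℕ → List ℕ
  | 0, l => l
  | k + 1, l => force (dot cs l / (unit * l.length) + 1) fun v => extend cs k (v :: l)

theorem length_extend (cs : List ℕ) (k : ℕ) (l : List ℕ) :
    (extend cs k l).length = l.length + k := by
  induction k generalizing l with
  | zero => rfl
  | succ k ih => rw [extend, force_eq, ih, List.length_cons]; omega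

theorem isBound_cons {f : ℕ → ℝ} {l : List ℕ} {v : ℕ} (hl : IsBound f l)
    (hv : unit * f l.length ≤ v) : IsBound f (v :: l) := by
  intro i hi
  rw [List.length_cons] at hi ⊢
  rcases Nat.lt_or_ge i l.length with h | h
  · rw [show l.length + 1 - 1 - i = (l.length - 1 - i) + 1 by omega, List.getD_cons_succ]
    exact hl i h
  · obtain rfl : i = l.length := by omega
    rw [show l.length + 1 - 1 - l.length = 0 by omega, List.getD_cons_zero]
    exact hv

theorem isBound_extend (T : ℕ × ℕ → Bool) (N k : ℕ) (l : List ℕ) (hne : 0 < l.length)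
    (hN : l.length + k ≤ N + 1) (hl : IsBound (blockProb T) l) :
    IsBound (blockProb T) (extend (coefBounds T N) k l) := by
  induction k generalizing l with
  | zero => exact hl
  | succ k ih =>
    rw [extend, force_eq]
    refine ih _ (by simp) (by rw [List.length_cons]; omega) (isBound_cons hl ?_)
    set n := l.length with hn
    have hu : (0 : ℝ) < unit := by norm_num [unit]
    have hn0 : (0 : ℝ) < n := by exact_mod_cast hne
    have hlen : (coefBounds T N).length = N := by simp [coefBounds]
    refine le_trans ?_ (natCast_div_le_div_add_one _ _)
    rw [dot_eq_sum _ _ n (by omega) hn.symm]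
    push_cast
    rw [le_div_iff₀ (by positivity)]
    have h := mul_blockProb_le T n
    have h2 : ∑ m ∈ Finset.Icc 1 n, recCoef T m * blockProb T (n - m) =
        ∑ i ∈ Finset.range n, recCoef T (i + 1) * blockProb T (n - (i + 1)) := by
      refine Finset.sum_nbij' (fun m => m - 1) (fun i => i + 1) ?_ ?_ ?_ ?_ ?_
      · intro m hm
        rw [Finset.mem_Icc] at hm
        rw [Finset.mem_range]
        omega
      · intro i hi
        rw [Finset.mem_range] at hi
        rw [Finset.mem_Icc]
        omega
      · intro m hm
        rw [Finset.mem_Icc] at hm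
        omega
      · intro i _
        rfl
      · intro m hm
        rw [Finset.mem_Icc] at hm
        rw [Nat.sub_add_cancel hm.1]
    rw [h2] at h
    calc (unit : ℝ) * blockProb T n * (unit * n) = unit * unit * (n * blockProb T n) := by ring
      _ ≤ unit * unit * ∑ i ∈ Finset.range n, recCoef T (i + 1) * blockProb T (n - (i + 1)) :=
          mul_le_mul_of_nonneg_left h (by positivity)
      _ = ∑ i ∈ Finset.range n,
            (unit * recCoef T (i + 1)) * (unit * blockProb T (n - (i + 1))) := by
          rw [Finset.mul_sum]
          exact Finset.sum_congr rfl fun i _ => by ring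
      _ ≤ _ := by
          refine Finset.sum_le_sum fun i hi => ?_
          rw [Finset.mem_range] at hi
          have h3 := hl (n - (i + 1)) (by omega)
          rw [show l.length - 1 - (n - (i + 1)) = i by omega] at h3
          have h4 : (coefBounds T N).getD i 0 = coefBound T (i + 1) := by
            rw [List.getD_eq_getElem _ _ (by omega)]
            simp [coefBounds]
          rw [h4]
          exact mul_le_mul (mul_recCoef_le_coefBound T (Nat.succ_pos i)) h3
            (mul_nonneg hu.le (blockProb_nonneg _ _)) (Nat.cast_nonneg _)

theorem blockProb_zero (T : ℕ × ℕ → Bool) : blockProb T 0 = 1 := by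
  have : (finite_blockPairs T 0).toFinset = {0} := by
    ext p
    rw [Set.Finite.mem_toFinset, Finset.mem_singleton]
    constructor
    · rintro ⟨D, hD⟩
      have h0 : D = 0 := by
        refine Multiset.eq_zero_of_forall_notMem fun t ht => ?_
        have h1 := blockSize_pos (hD.1 t ht).2
        have h2 := Multiset.le_sum_of_mem (Multiset.mem_map_of_mem blockSize ht)
        rw [hD.2.1] at h2
        omega
      rw [← hD.2.2, h0]
      simp
    · rintro rfl
      exact ⟨0, isDecomp_zero⟩
  simp [blockProb, this, wt_zero]

/-- Upper bounds for `blockProb (smallBlock 6) n`, for `n = 15, …, 1, 0`, in units of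
`1 / unit`. -/
def smallTable : List ℕ :=
  [3323362335, 5885888694, 10934968605, 19035827681, 32213424171, 49056504322, 81268227204,
  129488024382, 204832766446, 291666666672, 391666666672, 458333333338, 666666666670,
  1000000000005, 1000000000003, 1000000000003]

/-- The largest degree treated by computation. -/
def topDegree : ℕ := 120

/-- Upper bounds for `blockProb (smallBlock 6) n`, for `n = topDegree, …, 1, 0`. -/
def smallBounds : List ℕ :=
  forceNats (coefBounds (smallBlock 6) topDegree) fun cs => extend cs 105 smallTable

/-- Upper bounds for `blockProb (fun t => !smallBlock 6 t) n`, for `n = topDegree, …, 1, 0`. -/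
def largeBounds : List ℕ :=
  forceNats (coefBounds (fun t => !smallBlock 6 t) topDegree) fun cs => extend cs 120 [unit]

/-- Upper bounds for `blockProb (fun _ => true) n`, for `n = 0, 1, …, topDegree`, obtained from
`blockProb_le_sum`. -/
def probBounds : List ℕ :=
  forceNats smallBounds.reverse fun P => forceNats largeBounds fun R =>
    (List.range (topDegree + 1)).map fun n => dot P (R.drop (topDegree - n)) / unit + 1

theorem enumPairs_le_smallTable : ∀ n < 16,
    enumPairs (fun z => unit / z + 1) 5 6 n ≤ unit * smallTable.getD (15 - n) 0 := by
  decide +kernel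

theorem isBound_smallTable : IsBound (blockProb (smallBlock 6)) smallTable := by
  intro n hn
  have hu : (0 : ℝ) < unit := by norm_num [unit]
  have h1 := mul_blockProb_smallBlock_le unit 5 6 n
  have h2 : (enumPairs (fun z => unit / z + 1) 5 6 n : ℝ) ≤
      unit * smallTable.getD (15 - n) 0 := by
    exact_mod_cast enumPairs_le_smallTable n hn
  refine le_of_mul_le_mul_left ?_ hu
  calc (unit : ℝ) * (unit * blockProb (smallBlock 6) n) =
        unit ^ 2 * blockProb (smallBlock 6) n := by ring
    _ ≤ _ := h1.trans h2

theorem blockProb_le_probBounds {n : ℕ} (hn : n ≤ topDegree) :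
    unit * blockProb (fun _ => true) n ≤ probBounds.getD n 0 := by
  have hu : (0 : ℝ) < unit := by norm_num [unit]
  have hS : IsBound (blockProb (smallBlock 6)) smallBounds := by
    rw [smallBounds, forceNats_eq]
    exact isBound_extend _ _ _ _ (by simp [smallTable])
      (by simp [smallTable, topDegree]) isBound_smallTable
  have hL : IsBound (blockProb fun t => !smallBlock 6 t) largeBounds := by
    rw [largeBounds, forceNats_eq]
    refine isBound_extend _ _ _ _ (by simp) (by simp [topDegree]) fun i hi => ?_
    obtain rfl : i = 0 := by simpa using hi
    simp [blockProb_zero]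
  have lS : smallBounds.length = topDegree + 1 := by
    rw [smallBounds, forceNats_eq, length_extend]; simp [smallTable, topDegree]
  have lL : largeBounds.length = topDegree + 1 := by
    rw [largeBounds, forceNats_eq, length_extend]; simp [topDegree]
  have h1 : probBounds.getD n 0 =
      dot smallBounds.reverse (largeBounds.drop (topDegree - n)) / unit + 1 := by
    rw [probBounds, forceNats_eq, forceNats_eq, List.getD_eq_getElem _ _ (by simp; omega)]
    simp
  rw [h1]
  refine le_trans ?_ (natCast_div_le_div_add_one _ _)
  rw [le_div_iff₀ hu, dot_eq_sum _ _ (n + 1) (by rw [List.length_reverse]; omega)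
    (by rw [List.length_drop]; omega)]
  push_cast
  calc (unit : ℝ) * blockProb (fun _ => true) n * unit =
        unit * unit * blockProb (fun _ => true) n := by ring
    _ ≤ unit * unit * ∑ j ∈ Finset.range (n + 1),
          blockProb (smallBlock 6) j * blockProb (fun t => !smallBlock 6 t) (n - j) :=
        mul_le_mul_of_nonneg_left (blockProb_le_sum _ n) (mul_nonneg hu.le hu.le)
    _ = ∑ j ∈ Finset.range (n + 1), (unit * blockProb (smallBlock 6) j) *
          (unit * blockProb (fun t => !smallBlock 6 t) (n - j)) := by
        rw [Finset.mul_sum]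
        exact Finset.sum_congr rfl fun i _ => by ring
    _ ≤ _ := by
        refine Finset.sum_le_sum fun j hj => ?_
        rw [Finset.mem_range] at hj
        have h2 := hS j (by omega)
        have h3 := hL (n - j) (by omega)
        have h4 : smallBounds.reverse.getD j 0 =
            smallBounds.getD (smallBounds.length - 1 - j) 0 := by
          rw [List.getD_eq_getElem _ _ (by rw [List.length_reverse]; omega),
            List.getElem_reverse, List.getD_eq_getElem]
        have h5 : (largeBounds.drop (topDegree - n)).getD j 0 =
            largeBounds.getD (largeBounds.length - 1 - (n - j)) 0 := by
          rw [List.getD_eq_getElem _ _ (by rw [List.length_drop]; omega), List.getElem_drop,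
            ← List.getD_eq_getElem _ 0,
            show topDegree - n + j = largeBounds.length - 1 - (n - j) by omega]
        rw [h4, h5]
        exact mul_le_mul h2 h3 (mul_nonneg hu.le (blockProb_nonneg _ _)) (Nat.cast_nonneg _)

/-- The numerical facts about the tables: the bound `n ^ 2 * rho (S_n) ≤ 11.42747` in every degree
`n` with `1 ≤ n ≤ topDegree` and `n ≠ 10`, and the bounds for the two sums over fewer than `30`
terms that enter the induction for larger degrees. -/
def checkTables : Bool :=
  forceNats probBounds fun R => forceNats (coefBounds (fun _ => true) 29) fun c =>
    ((List.range (topDegree + 1)).all fun n => Nat.beq n 0 || Nat.beq n 10 ||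
      Nat.ble (n * n * R.getD n 0) 11427470000000) &&
    Nat.ble ((List.range 30).map fun i => R.getD i 0 * 120 / (120 - i) + 1).sum 6373000000000 &&
    Nat.ble c.sum 6760000000000

theorem checkTables_eq : checkTables = true := by decide +kernel

/-! ### Large degrees -/

theorem two_mul_cube_le (j : ℕ) (hj : 3 ≤ j) : 2 * j ^ 3 ≤ 9 * j.factorial := by
  induction j, hj using Nat.le_induction with
  | base => decide
  | succ j hj ih =>
    rw [Nat.factorial_succ]
    have h1 : (j + 1) ^ 2 ≤ j ^ 3 := by nlinarith [Nat.mul_le_mul hj (Nat.le_refl (j ^ 2))]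
    calc 2 * (j + 1) ^ 3 = (j + 1) * (2 * (j + 1) ^ 2) := by ring
      _ ≤ (j + 1) * (9 * j.factorial) := Nat.mul_le_mul_left _ (by omega)
      _ = _ := by ring

theorem wt_replicate_le {a j : ℕ} (ha : 0 < a) (hj : 3 ≤ j) :
    wt (Multiset.replicate j a) ≤ 9 / 2 / ((j * a : ℕ) : ℝ) ^ 3 := by
  rw [wt_replicate]
  have ha' : (1 : ℝ) ≤ a := by exact_mod_cast ha
  have hj' : (0 : ℝ) < j := by exact_mod_cast (by omega : 0 < j)
  have h1 : (2 : ℝ) * j ^ 3 ≤ 9 * j.factorial := by exact_mod_cast two_mul_cube_le j hj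
  have h2 : (a : ℝ) ^ 3 ≤ a ^ j := pow_le_pow_right₀ ha' hj
  have h3 : (0 : ℝ) < j.factorial := by exact_mod_cast j.factorial_pos
  rw [inv_le_comm₀ (by positivity) (by positivity), inv_div, div_div_eq_mul_div]
  rw [div_le_iff₀ (by norm_num)]
  push_cast
  calc ((j : ℝ) * a) ^ 3 * 2 = (a : ℝ) ^ 3 * (2 * (j : ℝ) ^ 3) := by ring
    _ ≤ (a : ℝ) ^ j * (9 * j.factorial) := mul_le_mul h2 h1 (by positivity) (by positivity)
    _ = _ := by ring

theorem sum_wt_replicate_le {m : ℕ} (hm : 0 < m) :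
    ∑ a ∈ m.divisors, wt (Multiset.replicate (m / a) a) ≤ (1 + 13 / 2 / (m : ℝ)) / m := by
  have hm' : (0 : ℝ) < m := by exact_mod_cast hm
  have hdiv : ∑ a ∈ m.divisors, wt (Multiset.replicate (m / a) a) =
      ∑ j ∈ m.divisors, wt (Multiset.replicate j (m / j)) := by
    rw [← Nat.sum_div_divisors]
    refine Finset.sum_congr rfl fun j hj => ?_
    rw [Nat.div_div_self (Nat.dvd_of_mem_divisors hj) hm.ne']
  rw [hdiv]
  have hj : ∀ j ∈ m.divisors, wt (Multiset.replicate j (m / j)) ≤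
      9 / 2 / (m : ℝ) ^ 3 + (if j = 1 then 1 / (m : ℝ) else 0) +
        (if j = 2 then 2 / (m : ℝ) ^ 2 else 0) := by
    intro j hj
    have hd := Nat.dvd_of_mem_divisors hj
    have hj0 := Nat.pos_of_mem_divisors hj
    have h92 : 0 ≤ 9 / 2 / (m : ℝ) ^ 3 := by positivity
    rcases Nat.lt_or_ge j 3 with h | h
    · interval_cases j
      · simp only [wt_replicate]
        norm_num
        positivity
      · obtain ⟨c, rfl⟩ := hd
        have hc : (0 : ℝ) < c := by
          exact_mod_cast (by omega : 0 < c)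
        have h2 : wt (Multiset.replicate 2 c) = 2 / ((2 * c : ℕ) : ℝ) ^ 2 := by
          rw [wt_replicate]
          push_cast
          field_simp
          norm_num [Nat.factorial]
        rw [Nat.mul_div_cancel_left c (by norm_num : 0 < 2), h2]
        norm_num at h92 ⊢
        exact h92
    · rw [if_neg (by omega), if_neg (by omega), add_zero, add_zero]
      have := wt_replicate_le (a := m / j) (j := j)
        (Nat.div_pos (Nat.le_of_dvd hm hd) hj0) h
      rwa [Nat.mul_div_cancel' hd] at this
  refine (Finset.sum_le_sum hj).trans ?_
  rw [Finset.sum_add_distrib, Finset.sum_add_distrib, Finset.sum_const, Finset.sum_ite_eq',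
    Finset.sum_ite_eq', nsmul_eq_mul]
  have h1 : (if 1 ∈ m.divisors then 1 / (m : ℝ) else 0) ≤ 1 / m := by
    split_ifs
    · exact le_rfl
    · positivity
  have h2 : (if 2 ∈ m.divisors then 2 / (m : ℝ) ^ 2 else 0) ≤ 2 / (m : ℝ) ^ 2 := by
    split_ifs
    · exact le_rfl
    · positivity
  have h3 : (m.divisors.card : ℝ) * (9 / 2 / (m : ℝ) ^ 3) ≤ m * (9 / 2 / (m : ℝ) ^ 3) := by
    refine mul_le_mul_of_nonneg_right ?_ (by positivity)
    exact_mod_cast Nat.card_divisors_le_self m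
  have h4 : m * (9 / 2 / (m : ℝ) ^ 3) + 1 / m + 2 / (m : ℝ) ^ 2 = (1 + 13 / 2 / (m : ℝ)) / m := by
    field_simp
    ring
  linarith

/-- The coefficients of the recursion are not much larger than `1 / m`; the main contribution comes
from the block `(m, m)`. -/
theorem recCoef_le (T : ℕ × ℕ → Bool) {m : ℕ} (hm : 0 < m) :
    recCoef T m ≤ (1 + 13 / 2 / (m : ℝ)) ^ 2 / m := by
  have hm' : (0 : ℝ) < m := by exact_mod_cast hm
  set x := ∑ a ∈ m.divisors, wt (Multiset.replicate (m / a) a) with hx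
  have hx0 : 0 ≤ x := Finset.sum_nonneg fun a _ => wt_nonneg _
  have h1 : ∑ t ∈ blocksOfSize T m, blockCost t ≤ x * x := by
    rw [hx, Finset.sum_mul_sum, ← Finset.sum_product']
    calc ∑ t ∈ blocksOfSize T m, blockCost t = ∑ t ∈ blocksOfSize T m,
          wt (Multiset.replicate (m / t.1) t.1) * wt (Multiset.replicate (m / t.2) t.2) := by
          refine Finset.sum_congr rfl fun t ht => ?_
          rw [blockCost, blockPair, ((mem_blocksOfSize hm).1 ht).1]
      _ ≤ _ := Finset.sum_le_sum_of_subset_of_nonneg (Finset.filter_subset _ _)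
          fun t _ _ => mul_nonneg (wt_nonneg _) (wt_nonneg _)
  have h2 := sum_wt_replicate_le hm
  calc recCoef T m ≤ m * (x * x) := mul_le_mul_of_nonneg_left h1 hm'.le
    _ ≤ m * ((1 + 13 / 2 / (m : ℝ)) / m * ((1 + 13 / 2 / (m : ℝ)) / m)) :=
        mul_le_mul_of_nonneg_left (mul_le_mul h2 h2 hx0 (by positivity)) hm'.le
    _ = _ := by field_simp

theorem recCoef_le_of_le (T : ℕ × ℕ → Bool) {m k : ℕ} (hk : 0 < k) (hkm : k ≤ m) :
    recCoef T m ≤ (1 + 13 / 2 / (k : ℝ)) ^ 2 / m := by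
  have hk' : (0 : ℝ) < k := by exact_mod_cast hk
  have hkm' : (k : ℝ) ≤ m := by exact_mod_cast hkm
  refine (recCoef_le T (hk.trans_le hkm)).trans ?_
  gcongr

/-- The probability that two random permutations of `n` points have commuting conjugates. -/
noncomputable def permCommProb (n : ℕ) : ℝ := blockProb (fun _ => true) n

theorem permCommProb_nonneg (n : ℕ) : 0 ≤ permCommProb n := blockProb_nonneg _ n

theorem checkTables_spec :
    (∀ n ≤ topDegree, n = 0 ∨ n = 10 ∨ n * n * probBounds.getD n 0 ≤ 11427470000000) ∧
    ((List.range 30).map fun i => probBounds.getD i 0 * 120 / (120 - i) + 1).sum ≤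
      6373000000000 ∧
    (coefBounds (fun _ => true) 29).sum ≤ 6760000000000 := by
  have h := checkTables_eq
  rw [checkTables, forceNats_eq, forceNats_eq, Bool.and_eq_true, Bool.and_eq_true,
    List.all_eq_true, Nat.ble_eq, Nat.ble_eq] at h
  refine ⟨fun n hn => ?_, h.1.2, h.2⟩
  have := h.1.1 n (List.mem_range.2 (Nat.lt_succ_of_le hn))
  rw [Bool.or_eq_true, Bool.or_eq_true, Nat.beq_eq, Nat.beq_eq, Nat.ble_eq] at this
  exact or_assoc.1 this

theorem sq_mul_permCommProb_le_of_le {n : ℕ} (hn : n ≤ topDegree) (h10 : n ≠ 10) :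
    (n : ℝ) ^ 2 * permCommProb n ≤ 11.42747 := by
  have h1 := blockProb_le_probBounds hn
  rcases checkTables_spec.1 n hn with rfl | h | h
  · norm_num
  · exact absurd h h10
  · generalize probBounds.getD n 0 = b at h h1
    have h2 : ((n * n * b : ℕ) : ℝ) ≤ 11427470000000 := by exact_mod_cast h
    push_cast at h2
    have h3 : (n : ℝ) * n * (unit * permCommProb n) ≤ n * n * b :=
      mul_le_mul_of_nonneg_left h1 (mul_self_nonneg _)
    have h4 : (unit : ℝ) = 1000000000000 := by norm_num [unit]
    rw [h4] at h3
    linarith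

/-- The part of the recursion for degree `n > topDegree` that comes from `permCommProb i` with
`i < 30`; the weight `120 / (120 - i)` bounds `n / (n - i)`. -/
theorem sum_permCommProb_mul_le :
    ∑ i ∈ Finset.range 30, permCommProb i * (120 / (120 - i)) ≤ 6.373 := by
  have h1 := checkTables_spec.2.1
  rw [← List.sum_toFinset _ List.nodup_range, List.toFinset_range] at h1
  have h2 : (∑ i ∈ Finset.range 30, ((probBounds.getD i 0 * 120 / (120 - i) + 1 : ℕ) : ℝ)) ≤
      6373000000000 := by exact_mod_cast h1
  have h4 : (unit : ℝ) = 1000000000000 := by norm_num [unit]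
  have h3 : unit * ∑ i ∈ Finset.range 30, permCommProb i * (120 / (120 - i)) ≤ 6373000000000 := by
    refine le_trans ?_ h2
    rw [Finset.mul_sum]
    refine Finset.sum_le_sum fun i hi => ?_
    rw [Finset.mem_range] at hi
    refine le_trans ?_ (natCast_div_le_div_add_one _ _)
    have hb := blockProb_le_probBounds (n := i) (by rw [topDegree]; omega)
    have hi' : (i : ℝ) < 30 := by exact_mod_cast hi
    rw [Nat.cast_sub (by omega)]
    push_cast
    rw [← mul_assoc, ← mul_div_assoc]
    refine div_le_div_of_nonneg_right ?_ (by linarith)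
    exact mul_le_mul_of_nonneg_right hb (by norm_num)
  rw [h4] at h3
  linarith

theorem sum_recCoef_le : ∑ m ∈ Finset.Icc 1 29, recCoef (fun _ => true) m ≤ 6.76 := by
  have h1 := checkTables_spec.2.2
  rw [coefBounds, ← List.sum_toFinset _ List.nodup_range, List.toFinset_range] at h1
  have h2 : (∑ i ∈ Finset.range 29, ((coefBound (fun _ => true) (i + 1) : ℕ) : ℝ)) ≤
      6760000000000 := by exact_mod_cast h1
  have h4 : (unit : ℝ) = 1000000000000 := by norm_num [unit]
  have h5 : ∑ m ∈ Finset.Icc 1 29, recCoef (fun _ => true) m =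
      ∑ i ∈ Finset.range 29, recCoef (fun _ => true) (i + 1) := by
    rw [Finset.range_eq_Ico, Finset.sum_Ico_add' (fun m => recCoef (fun _ => true) m) 0 29 1]
    rfl
  have h3 : unit * ∑ m ∈ Finset.Icc 1 29, recCoef (fun _ => true) m ≤ 6760000000000 := by
    refine le_trans ?_ h2
    rw [h5, Finset.mul_sum]
    exact Finset.sum_le_sum fun i _ => mul_recCoef_le_coefBound _ (Nat.succ_pos i)
  rw [h4] at h3
  linarith

theorem sum_one_div_sq_le (n : ℕ) (hn : 30 ≤ n) :
    ∑ i ∈ Finset.Ico 30 n, 1 / (i : ℝ) ^ 2 ≤ 1 / 29 - 1 / ((n : ℝ) - 1) := by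
  induction n, hn using Nat.le_induction with
  | base => norm_num
  | succ n hn ih =>
    rw [Finset.sum_Ico_succ_top hn]
    have h : (30 : ℝ) ≤ n := by exact_mod_cast hn
    have h2 : 1 / (n : ℝ) ^ 2 ≤ 1 / ((n : ℝ) - 1) - 1 / n := by
      rw [div_sub_div _ _ (by linarith) (by linarith), div_le_div_iff₀ (by positivity)
        (mul_pos (by linarith) (by linarith))]
      nlinarith
    push_cast
    rw [add_sub_cancel_right]
    linarith

/-- The induction step for degrees larger than `topDegree`. The recursion bounds `n * permCommProb
n` by a sum over `i + m = n`, in which the terms with `i < 30`, with `m < 30` and the remaining ones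
are estimated separately. -/
theorem sq_mul_permCommProb_le_of_lt {n : ℕ} (hn : topDegree < n)
    (ih : ∀ i < n, 30 ≤ i → (i : ℝ) ^ 2 * permCommProb i ≤ 11.42747) :
    (n : ℝ) ^ 2 * permCommProb n ≤ 11.42747 := by
  have hn' : 121 ≤ n := hn
  have hnR : (121 : ℝ) ≤ n := by exact_mod_cast hn'
  have hrec := mul_blockProb_le (fun _ => true) n
  set d : ℕ → ℝ := recCoef (fun _ => true) with hd
  have hd0 : ∀ m, 0 ≤ d m := recCoef_nonneg _
  have hrho : ∀ i < n, 30 ≤ i → permCommProb i ≤ 11.42747 / (i : ℝ) ^ 2 := by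
    intro i hi h30
    have : (0 : ℝ) < i := by exact_mod_cast (by omega : 0 < i)
    rw [le_div_iff₀ (by positivity), mul_comm]
    exact ih i hi h30
  have hsum : ∑ m ∈ Finset.Icc 1 n, d m * permCommProb (n - m) =
      ∑ i ∈ Finset.range n, d (n - i) * permCommProb i := by
    refine Finset.sum_nbij' (fun m => n - m) (fun i => n - i) ?_ ?_ ?_ ?_ ?_
    · intro m hm
      rw [Finset.mem_Icc] at hm
      rw [Finset.mem_range]
      omega
    · intro i hi
      rw [Finset.mem_range] at hi
      rw [Finset.mem_Icc]
      omega
    · intro m hm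
      rw [Finset.mem_Icc] at hm
      omega
    · intro i hi
      rw [Finset.mem_range] at hi
      omega
    · intro m hm
      rw [Finset.mem_Icc] at hm
      rw [Nat.sub_sub_self hm.2]
  have hsplit : ∑ i ∈ Finset.range n, d (n - i) * permCommProb i =
      ∑ i ∈ Finset.range 30, d (n - i) * permCommProb i +
      ∑ i ∈ Finset.Ico 30 (n - 29), d (n - i) * permCommProb i +
      ∑ i ∈ Finset.Ico (n - 29) n, d (n - i) * permCommProb i := by
    rw [Finset.range_eq_Ico, Finset.range_eq_Ico,
      Finset.sum_Ico_consecutive _ (by omega) (by omega),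
      Finset.sum_Ico_consecutive _ (by omega) (by omega)]
  -- `n / (n - i)` decreases with `n`, and `m = n - i` is at least `92`, so that the factor
  -- `(1 + 13 / (2 * m)) ^ 2` is at most `1.148`
  have hA : n * ∑ i ∈ Finset.range 30, d (n - i) * permCommProb i ≤ 1.148 * 6.373 := by
    calc n * ∑ i ∈ Finset.range 30, d (n - i) * permCommProb i ≤
          1.148 * ∑ i ∈ Finset.range 30, permCommProb i * (120 / (120 - i)) := by
          rw [Finset.mul_sum, Finset.mul_sum]
          refine Finset.sum_le_sum fun i hi => ?_
          rw [Finset.mem_range] at hi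
          have hiR : (i : ℝ) < 30 := by exact_mod_cast hi
          have hc : ((n - i : ℕ) : ℝ) = n - i := Nat.cast_sub (by omega)
          have h1 := recCoef_le_of_le (fun _ => true) (m := n - i) (k := 92) (by norm_num)
            (by omega)
          have h2 : n * d (n - i) ≤ 1.148 * (120 / (120 - i)) := by
            calc n * d (n - i) ≤ n * ((1 + 13 / 2 / ((92 : ℕ) : ℝ)) ^ 2 / ((n - i : ℕ) : ℝ)) :=
                  mul_le_mul_of_nonneg_left h1 (by linarith)
              _ = (1 + 13 / 2 / 92) ^ 2 * (n / (n - i)) := by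
                  rw [hc]; push_cast; ring
              _ ≤ 1.148 * (120 / (120 - i)) := by
                  refine mul_le_mul (by norm_num) ?_ ?_ (by norm_num)
                  · rw [div_le_div_iff₀ (by linarith) (by linarith)]
                    have : (0 : ℝ) ≤ i := i.cast_nonneg
                    nlinarith
                  · exact div_nonneg (by linarith) (by linarith)
          calc n * (d (n - i) * permCommProb i) = (n * d (n - i)) * permCommProb i := by ring
            _ ≤ (1.148 * (120 / (120 - i))) * permCommProb i :=
                mul_le_mul_of_nonneg_right h2 (permCommProb_nonneg i)
            _ = _ := by ring
      _ ≤ _ := mul_le_mul_of_nonneg_left sum_permCommProb_mul_le (by norm_num)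
  -- both `i` and `m = n - i` are at least `30`, so that the factor is at most `1.481`
  have hB : n * ∑ i ∈ Finset.Ico 30 (n - 29), d (n - i) * permCommProb i ≤
      1.481 * 11.42747 * (1 / 29 + 1 / 15) := by
    have hterm : ∀ i ∈ Finset.Ico 30 (n - 29), n * (d (n - i) * permCommProb i) ≤
        1.481 * 11.42747 * (1 / (i : ℝ) ^ 2 + 1 / (15 * n)) := by
      intro i hi
      rw [Finset.mem_Ico] at hi
      have hiR : (30 : ℝ) ≤ i := by exact_mod_cast hi.1
      have hc : ((n - i : ℕ) : ℝ) = n - i := Nat.cast_sub (by omega)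
      have hmR : (30 : ℝ) ≤ n - i := by
        rw [← hc]; exact_mod_cast (by omega : 30 ≤ n - i)
      have h1 := recCoef_le_of_le (fun _ => true) (m := n - i) (k := 30) (by norm_num) (by omega)
      have h1' : d (n - i) ≤ 1.481 / (n - i) := by
        refine h1.trans ?_
        rw [hc]
        refine div_le_div_of_nonneg_right ?_ (by linarith)
        norm_num
      have h2 := hrho i (by omega) hi.1
      have h3 : d (n - i) * permCommProb i ≤ 1.481 / (n - i) * (11.42747 / (i : ℝ) ^ 2) :=
        mul_le_mul h1' h2 (permCommProb_nonneg i) (div_nonneg (by norm_num) (by linarith))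
      -- the partial fraction `n / (m * i ^ 2) = 1 / i ^ 2 + (1 / m + 1 / i) / n` with `m = n - i`
      have h4 : (n : ℝ) * (1.481 / (n - i) * (11.42747 / (i : ℝ) ^ 2)) =
          1.481 * 11.42747 * (1 / (i : ℝ) ^ 2 + 1 / n * (1 / (n - i) + 1 / i)) := by
        have e1 : (n : ℝ) - i ≠ 0 := by linarith
        have e2 : (i : ℝ) ≠ 0 := by linarith
        have e3 : (n : ℝ) ≠ 0 := by linarith
        field_simp
        ring
      have h5 : 1 / (n : ℝ) * (1 / (n - i) + 1 / i) ≤ 1 / (15 * n) := by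
        have e1 : 1 / ((n : ℝ) - i) ≤ 1 / 30 := one_div_le_one_div_of_le (by norm_num) hmR
        have e2 : 1 / (i : ℝ) ≤ 1 / 30 := one_div_le_one_div_of_le (by norm_num) hiR
        have e3 : 1 / (15 * (n : ℝ)) = 1 / n * (1 / 15) := by ring
        rw [e3]
        refine mul_le_mul_of_nonneg_left (by linarith) (by positivity)
      refine (mul_le_mul_of_nonneg_left h3 (by linarith)).trans ?_
      rw [h4]
      refine mul_le_mul_of_nonneg_left (by linarith) (by norm_num)
    rw [Finset.mul_sum]
    refine (Finset.sum_le_sum hterm).trans ?_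
    rw [← Finset.mul_sum, Finset.sum_add_distrib, Finset.sum_const, nsmul_eq_mul, Nat.card_Ico]
    refine mul_le_mul_of_nonneg_left (add_le_add ?_ ?_) (by norm_num)
    · refine (sum_one_div_sq_le (n - 29) (by omega)).trans ?_
      have : (0 : ℝ) ≤ 1 / (((n - 29 : ℕ) : ℝ) - 1) := by
        rw [Nat.cast_sub (by omega)]
        refine div_nonneg zero_le_one ?_
        push_cast
        linarith
      linarith
    · have h1 : ((n - 29 - 30 : ℕ) : ℝ) ≤ n := by exact_mod_cast (by omega : n - 29 - 30 ≤ n)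
      calc ((n - 29 - 30 : ℕ) : ℝ) * (1 / (15 * n)) ≤ n * (1 / (15 * n)) :=
            mul_le_mul_of_nonneg_right h1 (by positivity)
        _ = 1 / 15 := by
            have : (n : ℝ) ≠ 0 := by linarith
            field_simp
  -- `n / (n - 29) ^ 2` decreases with `n`, hence is at most its value at `n = 121`
  have hC : n * ∑ i ∈ Finset.Ico (n - 29) n, d (n - i) * permCommProb i ≤
      6.76 * 11.42747 * (121 / 92 ^ 2) := by
    have hre : ∑ i ∈ Finset.Ico (n - 29) n, d (n - i) * permCommProb i =
        ∑ m ∈ Finset.Icc 1 29, d m * permCommProb (n - m) := by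
      refine Finset.sum_nbij' (fun i => n - i) (fun m => n - m) ?_ ?_ ?_ ?_ ?_
      · intro m hm
        rw [Finset.mem_Ico] at hm
        rw [Finset.mem_Icc]
        omega
      · intro i hi
        rw [Finset.mem_Icc] at hi
        rw [Finset.mem_Ico]
        omega
      · intro m hm
        rw [Finset.mem_Ico] at hm
        omega
      · intro i hi
        rw [Finset.mem_Icc] at hi
        omega
      · intro m hm
        rw [Finset.mem_Ico] at hm
        rw [Nat.sub_sub_self hm.2.le]
    rw [hre, Finset.mul_sum]
    have hterm : ∀ m ∈ Finset.Icc 1 29, n * (d m * permCommProb (n - m)) ≤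
        d m * (11.42747 * (121 / 92 ^ 2)) := by
      intro m hm
      rw [Finset.mem_Icc] at hm
      have hmR : (m : ℝ) ≤ 29 := by exact_mod_cast hm.2
      have h1 := hrho (n - m) (by omega) (by omega)
      rw [Nat.cast_sub (by omega)] at h1
      have h2 : n * permCommProb (n - m) ≤ 11.42747 * (121 / 92 ^ 2) := by
        refine (mul_le_mul_of_nonneg_left h1 (by linarith)).trans ?_
        rw [← mul_div_assoc, mul_comm, mul_div_assoc]
        refine mul_le_mul_of_nonneg_left ?_ (by norm_num)
        have h3 : (0 : ℝ) < n - 29 := by linarith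
        calc (n : ℝ) / (n - m) ^ 2 ≤ n / (n - 29) ^ 2 := by
              refine div_le_div_of_nonneg_left (by linarith) (by positivity) ?_
              exact pow_le_pow_left₀ h3.le (by linarith) 2
          _ ≤ _ := by
              rw [div_le_div_iff₀ (by positivity) (by norm_num)]
              nlinarith
      calc n * (d m * permCommProb (n - m)) = d m * (n * permCommProb (n - m)) := by ring
        _ ≤ _ := mul_le_mul_of_nonneg_left h2 (hd0 m)
    refine (Finset.sum_le_sum hterm).trans ?_
    rw [← Finset.sum_mul, mul_assoc]
    exact mul_le_mul_of_nonneg_right sum_recCoef_le (by norm_num)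
  have hfin : (n : ℝ) * (n * permCommProb n) ≤
      n * ∑ i ∈ Finset.range n, d (n - i) * permCommProb i := by
    rw [← hsum]
    exact mul_le_mul_of_nonneg_left hrec (by linarith)
  rw [hsplit, mul_add, mul_add] at hfin
  have hnum : (1.148 : ℝ) * 6.373 + 1.481 * 11.42747 * (1 / 29 + 1 / 15) +
      6.76 * 11.42747 * (121 / 92 ^ 2) ≤ 11.42747 := by norm_num
  calc (n : ℝ) ^ 2 * permCommProb n = n * (n * permCommProb n) := by ring
    _ ≤ _ := by linarith

theorem sq_mul_permCommProb_le {n : ℕ} (h10 : n ≠ 10) :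
    (n : ℝ) ^ 2 * permCommProb n ≤ 11.42747 := by
  induction n using Nat.strong_induction_on with
  | h n ih =>
    rcases Nat.lt_or_ge topDegree n with h | h
    · exact sq_mul_permCommProb_le_of_lt h fun i hi h30 => ih i hi (by omega)
    · exact sq_mul_permCommProb_le_of_le h h10

/-! ### Degree ten -/

theorem nodup_code_ten : ((codeList (fun z => unit / z) 3 10 10).map Prod.fst).Nodup := by
  decide +kernel

theorem le_enumPairs_ten :
    114274700000 * unit < enumPairs (fun z => unit / z) 3 10 10 := by
  decide +kernel

theorem enumPairs_ten_le :
    enumPairs (fun z => unit / z + 1) 3 10 10 < 114274800000 * unit := by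
  decide +kernel

theorem permCommProb_ten : 0.1142747 < permCommProb 10 ∧ permCommProb 10 < 0.1142748 := by
  have hu : (unit : ℝ) = 1000000000000 := by norm_num [unit]
  rw [permCommProb, blockProb_eq_smallBlock le_rfl]
  constructor
  · have h1 := enumPairs_le_mul_blockProb nodup_code_ten
    have h2 : ((114274700000 * unit : ℕ) : ℝ) < enumPairs (fun z => unit / z) 3 10 10 := by
      exact_mod_cast le_enumPairs_ten
    have h3 := h2.trans_le h1
    push_cast at h3
    rw [hu] at h3
    linarith
  · have h1 := mul_blockProb_smallBlock_le unit 3 10 10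
    have h2 : (enumPairs (fun z => unit / z + 1) 3 10 10 : ℝ) <
        ((114274800000 * unit : ℕ) : ℝ) := by exact_mod_cast enumPairs_ten_le
    have h3 := h1.trans_lt h2
    push_cast at h3
    rw [hu] at h3
    linarith

theorem theorem6 :
    (∀ n : ℕ, 1 ≤ n → rho (Equiv.Perm (Fin n)) ≤ constRho / (n : ℝ) ^ 2) ∧
    (∀ C : ℝ, (∀ n : ℕ, 1 ≤ n → rho (Equiv.Perm (Fin n)) ≤ C / (n : ℝ) ^ 2) → constRho ≤ C) ∧
    (11.42747 < constRho ∧ constRho < 11.42748) := by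
  have hrho : ∀ n, rho (Equiv.Perm (Fin n)) = permCommProb n := rho_perm_eq
  have hC : constRho = 100 * permCommProb 10 := by rw [constRho, hrho]; norm_num
  have h10 := permCommProb_ten
  refine ⟨fun n hn => ?_, fun C h => ?_, by linarith, by linarith⟩
  · have hn' : (0 : ℝ) < n := by exact_mod_cast hn
    rw [hrho, le_div_iff₀ (by positivity), mul_comm]
    rcases eq_or_ne n 10 with rfl | hne
    · rw [hC]
      norm_num
    · have := sq_mul_permCommProb_le hne
      linarith
  · have := h 10 (by norm_num)
    rw [hrho] at this
    rw [hC]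
    norm_num at this
    linarith
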